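/- For positive integers $d,n$, nonnegative integer matrices $w^1,\dots,w^d\in\mathbb{Z}_{\ge 0}^{n\times n}$ and $x\in\mathbb{R}^{n\times n}$, put $w^kx:=\sum_{i,j}w^k_{i,j}x_{i,j}$. For $1\le p\le\infty$ consider the maximum nonlinear bipartite matching problem with the $l_p$ norm: maximize $\|(w^1x,\dots,w^dx)\|_p$ over all $n\times n$ permutation matrices $x$ (that is, over all perfect matchings of $K_{n,n}$). Here $\|y\|_p=(\sum_{k=1}^d|y_k|^p)^{1/p}$ for $p<\infty$ and $\|y\|_\infty=\max_k|y_k|$. If the maximum is $g^*$, a permutation matrix with objective value $g$ is an $r$-approximative solution if $\frac1r g^*\le g\le r g^*$. 1. Let $d,n,p,w^1,\dots,w^d$ be as above. For $k=1,\dots,d$ let $x^k$ be a permutation matrix that maximizes the linear function $x\mapsto w^kx$ over the Birkhoff polytope of bistochastic $n\times n$ matrices, and let $x^r$ be one of $x^1,\dots,x^d$ with largest objective value $\|(w^1x^r,\dots,w^dx^r)\|_p$. Then $x^r$ is a $d^{1/p}$-approximative solution (with $d^{1/\infty}=1$), and for $p=\infty$ it is an optimal solution. 2. There is a single deterministic algorithm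 that, given any positive integers $d,n$, any nonnegative integer matrices $w^1,\dots,w^d\in\mathbb{Z}_{\ge 0}^{n\times n}$, and any norm $\|\cdot\|_p$ with $1\le p\le\infty$, presented only by a comparison oracle that, queried on $y,z\in\mathbb{Z}^d$, asserts whether $\|y\|_p\le\|z\|_p$, outputs a permutation matrix $x^r$ of the kind described in part 1. Hence it determines a $d^{1/p}$-approximative solution, which is optimal for $p=\infty$. Its oracle-time (the running time, with every operation charged by the bit lengths of the integers involved, plus the number of oracle queries) is bounded by a polynomial, independent of $p$, in $d$, $n$ and the maximal bit size of the weights $w^k_{i,j}$. -/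

import Mathlib

open scoped ENNReal

/-! ### The optimization problem

Perfect matchings of the complete bipartite graph `K_{n,n}` are identified with permutations
`σ` of `Fin n` (the matching consists of the edges `(i, σ i)`) and with their permutation
matrices `σ.permMatrix ℝ`, whose `(i, j)` entry is `1` if `σ i = j` and `0` otherwise. -/

namespace NonlinearMatching

/-- The projection `x ↦ w · x = (w¹ x, …, wᵈ x)`, where `wᵏ x = ∑ i, ∑ j, wᵏᵢⱼ xᵢⱼ`. -/
def proj {d n : ℕ} (w : Fin d → Matrix (Fin n) (Fin n) ℕ) (x : Matrix (Fin n) (Fin n) ℝ) :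
    Fin d → ℝ :=
  fun k => ∑ i, ∑ j, (w k i j : ℝ) * x i j

/-- The `l_p` norm on `ℝᵈ`: `(∑ k, |y k| ^ p) ^ (1 / p)` for `1 ≤ p < ∞`, and `max_k |y k|` for
`p = ∞`. -/
noncomputable def lpNorm (p : ℝ≥0∞) {d : ℕ} (y : Fin d → ℝ) : ℝ :=
  ‖(WithLp.toLp p y : PiLp p (fun _ : Fin d => ℝ))‖

/-- The objective value `‖(w¹ x, …, wᵈ x)‖_p` of the permutation matrix `x` of `σ`. -/
noncomputable def objective {d n : ℕ} (p : ℝ≥0∞) (w : Fin d → Matrix (Fin n) (Fin n) ℕ)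
    (σ : Equiv.Perm (Fin n)) : ℝ :=
  lpNorm p (proj w (σ.permMatrix ℝ))

/-- `s` is an optimal solution of the problem of maximizing `g` over `S`. -/
def IsOptimal {S : Type*} (g : S → ℝ) (s : S) : Prop :=
  ∀ s', g s' ≤ g s

/-- `s` is an `r`-approximative solution of the problem of maximizing `g` over `S`. -/
def IsApproximative {S : Type*} (g : S → ℝ) (r : ℝ) (s : S) : Prop :=
  ∃ sopt, IsOptimal g sopt ∧ 1 / r * g sopt ≤ g s ∧ g s ≤ r * g sopt

/-- `σ` is a best one, with respect to the `l_p` norm objective, among `d` permutation matrices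
(that is, vertices of the Birkhoff polytope) the `k`-th of which maximizes the linear objective
`wᵏ` over the Birkhoff polytope of bistochastic matrices. -/
def IsBestOfLinearMaximizers {d n : ℕ} (p : ℝ≥0∞) (w : Fin d → Matrix (Fin n) (Fin n) ℕ)
    (σ : Equiv.Perm (Fin n)) : Prop :=
  ∃ τ : Fin d → Equiv.Perm (Fin n),
    (∀ k, ∀ x ∈ doublyStochastic ℝ (Fin n), proj w x k ≤ proj w ((τ k).permMatrix ℝ) k) ∧
    ∃ r, (∀ k, objective p w (τ k) ≤ objective p w (τ r)) ∧ σ = τ r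

/-- The maximal bit size of the weights. -/
def maxBitSize {d n : ℕ} (w : Fin d → Matrix (Fin n) (Fin n) ℕ) : ℕ :=
  Finset.univ.sup fun t : Fin d × Fin n × Fin n => (w t.1 t.2.1 t.2.2).size

/-- The comparison oracle presenting the `l_p` norm: queried on `y, z ∈ ℤᵈ`, it asserts whether
`‖y‖_p ≤ ‖z‖_p`. -/
def comparisonOracle (p : ℝ≥0∞) (d : ℕ) (y z : Fin d → ℤ) : Prop :=
  lpNorm p (fun k => (y k : ℝ)) ≤ lpNorm p (fun k => (z k : ℝ))

end NonlinearMatching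

/-! ### The machine model

Random access machines with logarithmic (bit) cost and an oracle, programmed by `while`
programs. The memory consists of integer variables and of integer arrays, all named by natural
numbers that are fixed in the program text (so a program uses finitely many of them); array
indices are computed at run time. -/

namespace OracleRAM

/-- The memory contents. -/
structure Store where
  var : ℕ → ℤ
  arr : ℕ → ℤ → ℤ

/-- Write the value `v` into the variable `x`. -/
def Store.setVar (s : Store) (x : ℕ) (v : ℤ) : Store :=
  { s with var := Function.update s.var x v }

/-- Write the value `v` into the cell with index `i` of the array `a`. -/
def Store.setArr (s : Store) (a : ℕ) (i v : ℤ) : Store :=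
  { s with arr := Function.update s.arr a (Function.update (s.arr a) i v) }

/-- Integer expressions. `le` is the comparison, with values `1` (true) and `0` (false). -/
inductive Expr where
  | const (c : ℤ)
  | var (x : ℕ)
  | read (a : ℕ) (i : Expr)
  | add (e₁ e₂ : Expr)
  | sub (e₁ e₂ : Expr)
  | mul (e₁ e₂ : Expr)
  | le (e₁ e₂ : Expr)

/-- The value of an expression. -/
def Expr.eval (s : Store) : Expr → ℤ
  | const c => c
  | var x => s.var x
  | read a i => s.arr a (i.eval s)
  | add e₁ e₂ => e₁.eval s + e₂.eval s
  | sub e₁ e₂ => e₁.eval s - e₂.eval s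
  | mul e₁ e₂ => e₁.eval s * e₂.eval s
  | le e₁ e₂ => if e₁.eval s ≤ e₂.eval s then 1 else 0

/-- The cost of handling one integer: one more than the bit length of its absolute value. -/
def bitCost (v : ℤ) : ℕ :=
  v.natAbs.size + 1

/-- The cost of evaluating an expression: the values of all its subexpressions, which include
all operands, array indices and results, are charged by their bit length. -/
def Expr.cost (s : Store) : Expr → ℕ
  | const c => bitCost c
  | var x => bitCost (s.var x)
  | read a i => i.cost s + bitCost (s.arr a (i.eval s))
  | add e₁ e₂ => e₁.cost s + e₂.cost s + bitCost (e₁.eval s + e₂.eval s)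
  | sub e₁ e₂ => e₁.cost s + e₂.cost s + bitCost (e₁.eval s - e₂.eval s)
  | mul e₁ e₂ => e₁.cost s + e₂.cost s + bitCost (e₁.eval s * e₂.eval s)
  | le e₁ e₂ => e₁.cost s + e₂.cost s + 1

/-- Programs. A test succeeds if its value is nonzero. `query x a b` queries the oracle on the
vectors stored in the arrays `a` and `b`, and stores the answer (`1` or `0`) in `x`. -/
inductive Prog where
  | skip
  | assign (x : ℕ) (e : Expr)
  | store (a : ℕ) (i e : Expr)
  | query (x a b : ℕ)
  | seq (c₁ c₂ : Prog)
  | cond (e : Expr) (c₁ c₂ : Prog)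
  | loop (e : Expr) (c : Prog)

/-- The vector in `ℤᵈ` stored in the cells `0, …, d - 1` of the array `a`. -/
def Store.vec (s : Store) (d a : ℕ) : Fin d → ℤ :=
  fun k => s.arr a ((k : ℕ) : ℤ)

/-- The oracle-time of one query: `1` for the query, plus the time for reading the two vectors
it is made on. -/
def queryCost {d : ℕ} (y z : Fin d → ℤ) : ℕ :=
  1 + ∑ k, (bitCost (y k) + bitCost (z k))

/-- `Run O c s s' t`: started with memory contents `s` and given the oracle `O`, the program `c`
halts with memory contents `s'` after oracle-time (running time plus number of oracle
queries) `t`. -/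
inductive Run {d : ℕ} (O : (Fin d → ℤ) → (Fin d → ℤ) → Prop) :
    Prog → Store → Store → ℕ → Prop where
  | skip (s : Store) : Run O .skip s s 1
  | assign (x : ℕ) (e : Expr) (s : Store) :
      Run O (.assign x e) s (s.setVar x (e.eval s)) (1 + e.cost s)
  | store (a : ℕ) (i e : Expr) (s : Store) :
      Run O (.store a i e) s (s.setArr a (i.eval s) (e.eval s)) (1 + i.cost s + e.cost s)
  | query_true (x a b : ℕ) (s : Store) (h : O (s.vec d a) (s.vec d b)) :
      Run O (.query x a b) s (s.setVar x 1) (1 + queryCost (s.vec d a) (s.vec d b))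
  | query_false (x a b : ℕ) (s : Store) (h : ¬ O (s.vec d a) (s.vec d b)) :
      Run O (.query x a b) s (s.setVar x 0) (1 + queryCost (s.vec d a) (s.vec d b))
  | seq {c₁ c₂ : Prog} {s s₁ s₂ : Store} {t₁ t₂ : ℕ}
      (h₁ : Run O c₁ s s₁ t₁) (h₂ : Run O c₂ s₁ s₂ t₂) :
      Run O (.seq c₁ c₂) s s₂ (t₁ + t₂)
  | cond_true {e : Expr} {c₁ c₂ : Prog} {s s₁ : Store} {t : ℕ}
      (he : e.eval s ≠ 0) (h : Run O c₁ s s₁ t) :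
      Run O (.cond e c₁ c₂) s s₁ (1 + e.cost s + t)
  | cond_false {e : Expr} {c₁ c₂ : Prog} {s s₁ : Store} {t : ℕ}
      (he : e.eval s = 0) (h : Run O c₂ s s₁ t) :
      Run O (.cond e c₁ c₂) s s₁ (1 + e.cost s + t)
  | loop_true {e : Expr} {c : Prog} {s s₁ s₂ : Store} {t₁ t₂ : ℕ}
      (he : e.eval s ≠ 0) (h₁ : Run O c s s₁ t₁) (h₂ : Run O (.loop e c) s₁ s₂ t₂) :
      Run O (.loop e c) s s₂ (1 + e.cost s + t₁ + t₂)
  | loop_false {e : Expr} {c : Prog} {s : Store} (he : e.eval s = 0) :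
      Run O (.loop e c) s s (1 + e.cost s)

/-- The machine is deterministic: final memory contents and oracle-time are unique. -/
theorem Run.unique {d : ℕ} {O : (Fin d → ℤ) → (Fin d → ℤ) → Prop} {c : Prog}
    {s s₁ s₂ : Store} {t₁ t₂ : ℕ} (h₁ : Run O c s s₁ t₁) (h₂ : Run O c s s₂ t₂) :
    s₁ = s₂ ∧ t₁ = t₂ := by
  induction h₁ generalizing s₂ t₂ with
  | skip s => cases h₂; exact ⟨rfl, rfl⟩
  | assign x e s => cases h₂; exact ⟨rfl, rfl⟩
  | store a i e s => cases h₂; exact ⟨rfl, rfl⟩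
  | query_true x a b s h =>
    cases h₂ with
    | query_true => exact ⟨rfl, rfl⟩
    | query_false _ _ _ _ h' => exact absurd h h'
  | query_false x a b s h =>
    cases h₂ with
    | query_true _ _ _ _ h' => exact absurd h' h
    | query_false => exact ⟨rfl, rfl⟩
  | seq _ _ ih₁ ih₂ =>
    cases h₂ with
    | seq g₁ g₂ =>
      obtain ⟨rfl, rfl⟩ := ih₁ g₁
      obtain ⟨rfl, rfl⟩ := ih₂ g₂
      exact ⟨rfl, rfl⟩
  | cond_true he _ ih =>
    cases h₂ with
    | cond_true _ g => obtain ⟨rfl, rfl⟩ := ih g; exact ⟨rfl, rfl⟩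
    | cond_false he' _ => exact absurd he' he
  | cond_false he _ ih =>
    cases h₂ with
    | cond_true he' _ => exact absurd he he'
    | cond_false _ g => obtain ⟨rfl, rfl⟩ := ih g; exact ⟨rfl, rfl⟩
  | loop_true he _ _ ih₁ ih₂ =>
    cases h₂ with
    | loop_true _ g₁ g₂ =>
      obtain ⟨rfl, rfl⟩ := ih₁ g₁
      obtain ⟨rfl, rfl⟩ := ih₂ g₂
      exact ⟨rfl, rfl⟩
    | loop_false he' => exact absurd he' he
  | loop_false he =>
    cases h₂ with
    | loop_true he' _ _ => exact absurd he he'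
    | loop_false => exact ⟨rfl, rfl⟩

end OracleRAM

namespace NonlinearMatching

/-- `s` is the initial memory contents for the input `d, n, w¹, …, wᵈ`: variable `0` holds `d`,
variable `1` holds `n`, array `0` lists the entries `wᵏᵢⱼ` in lexicographic order of
`(k, i, j)`, and everything else is `0`. -/
def IsInput {d n : ℕ} (w : Fin d → Matrix (Fin n) (Fin n) ℕ) (s : OracleRAM.Store) : Prop :=
  s.var 0 = d ∧ s.var 1 = n ∧ (∀ x, 2 ≤ x → s.var x = 0) ∧
  (∀ (k : Fin d) (i j : Fin n),
    s.arr 0 ((((k : ℕ) * n + i) * n + j : ℕ) : ℤ) = (w k i j : ℤ)) ∧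
  (∀ m : ℤ, m < 0 ∨ ((d * n * n : ℕ) : ℤ) ≤ m → s.arr 0 m = 0) ∧
  (∀ a, 1 ≤ a → ∀ m, s.arr a m = 0)

/-- The memory contents `s` outputs the permutation matrix of `σ`: array `1` lists its entries
row by row. -/
def IsOutput {n : ℕ} (s : OracleRAM.Store) (σ : Equiv.Perm (Fin n)) : Prop :=
  ∀ i j : Fin n, s.arr 1 (((i : ℕ) * n + j : ℕ) : ℤ) = σ.permMatrix ℤ i j

end NonlinearMatching

/-!
The approximation guarantee compares norms. By `PiLp.antilipschitzWith_ofLp` the `l_p` norm is at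
most `d ^ (1 / p)` times the maximum norm, and no matching has a `k`-th coordinate larger than that
of the `k`-th linear maximizer, which in turn is at most the `l_p` norm of that maximizer. So the
best of the maximizers loses at most the factor `d ^ (1 / p)`
(`IsBestOfLinearMaximizers.isApproximative`).

The algorithm solves the `d` assignment problems by the Hungarian method, computes the vectors
`(w¹ x, …, wᵈ x)` of the solutions, and keeps the best one according to the oracle. For one weight
matrix it maintains a dual solution `u, v` with `wᵢⱼ ≤ uᵢ + vⱼ` and a matching of the first rows by
tight edges. To match one more row, an alternating tree of tight edges grows from it
(`Tree.extend`), after a shift of the dual solution whenever needed (`Tree.dual_shift`), until it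
reaches a free column; as a closed tree contains fewer than `n` columns (`lt_of_closed`), `n` rounds
suffice. Then the matching is exchanged along the tree path (`Augmenting.step`). When every row is
matched, weak duality (`proj_le_of_dual`) shows that the matching is optimal over the whole
Birkhoff polytope.

The running time needs no analysis of this particular algorithm. It is written as a bounded program
(`Cmd`), in which all loops run over ranges of length `d`, `n` or `n + 1`, and it never multiplies:
addresses come from tables of the multiples of `n` and `n * n`. Every operation thus lengthens the
numbers in memory by at most a constant, so that after polynomially many operations all numbers
still have polynomial bit length. `Cmd.exists_run` proves by induction on the program that every
such program halts in polynomial time. The semantics `Cmd.exec` of bounded programs is a total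
function, and correctness is proved about it with the invariant rule `Cmd.exec_forLt`.
-/

namespace OracleRAM

/-! ### Bounded programs -/

/-- Bounded programs: `while` programs whose only loops are `forLt x b c`, which runs `c` for
`x = 0, …, v - 1`, where `v` is the value of the variable `b`. -/
inductive Cmd where
  | skip
  | assign (x : ℕ) (e : Expr)
  | store (a : ℕ) (i e : Expr)
  | query (x a b : ℕ)
  | seq (c₁ c₂ : Cmd)
  | cond (e : Expr) (c₁ c₂ : Cmd)
  | forLt (x b : ℕ) (c : Cmd)

namespace Cmd

/-- The `while` program of a bounded program. -/
def compile : Cmd → Prog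
  | skip => .skip
  | assign x e => .assign x e
  | store a i e => .store a i e
  | query x a b => .query x a b
  | seq c₁ c₂ => .seq c₁.compile c₂.compile
  | cond e c₁ c₂ => .cond e c₁.compile c₂.compile
  | forLt x b c => .seq (.assign x (.const 0))
      (.loop (.le (.add (.var x) (.const 1)) (.var b))
        (.seq c.compile (.assign x (.add (.var x) (.const 1)))))

/-- The effect of setting the counter `x` to `0` and running `m` rounds of a loop with body `f`. -/
def iter (x : ℕ) (f : Store → Store) (s : Store) : ℕ → Store
  | 0 => s.setVar x 0
  | m + 1 => (f (iter x f s m)).setVar x (m + 1)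

open Classical in
/-- The memory contents after running a bounded program. -/
noncomputable def exec {d : ℕ} (O : (Fin d → ℤ) → (Fin d → ℤ) → Prop) : Cmd → Store → Store
  | skip, s => s
  | assign x e, s => s.setVar x (e.eval s)
  | store a i e, s => s.setArr a (i.eval s) (e.eval s)
  | query x a b, s => s.setVar x (if O (s.vec d a) (s.vec d b) then 1 else 0)
  | seq c₁ c₂, s => c₂.exec O (c₁.exec O s)
  | cond e c₁ c₂, s => if e.eval s ≠ 0 then c₁.exec O s else c₂.exec O s
  | forLt x b c, s => iter x (c.exec O) s (s.var b).toNat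

/-- The variables that a program may write. -/
def wvars : Cmd → List ℕ
  | skip => []
  | assign x _ => [x]
  | store _ _ _ => []
  | query x _ _ => [x]
  | seq c₁ c₂ => c₁.wvars ++ c₂.wvars
  | cond _ c₁ c₂ => c₁.wvars ++ c₂.wvars
  | forLt x _ c => x :: c.wvars

/-- The arrays that a program may write. -/
def warrs : Cmd → List ℕ
  | skip => []
  | assign _ _ => []
  | store a _ _ => [a]
  | query _ _ _ => []
  | seq c₁ c₂ => c₁.warrs ++ c₂.warrs
  | cond _ c₁ c₂ => c₁.warrs ++ c₂.warrs
  | forLt _ _ c => c.warrs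

end Cmd

/-- The expression contains no multiplication. -/
def Expr.mulFree : Expr → Bool
  | const _ => true
  | var _ => true
  | read _ i => i.mulFree
  | add e₁ e₂ => e₁.mulFree && e₂.mulFree
  | sub e₁ e₂ => e₁.mulFree && e₂.mulFree
  | mul _ _ => false
  | le e₁ e₂ => e₁.mulFree && e₂.mulFree

/-- The program does not multiply, every loop is bounded by one of the variables `0`, `1`, `2`,
which are never written, and no loop body writes the loop counter. -/
def Cmd.tame : Cmd → Bool
  | skip => true
  | assign x e => decide (3 ≤ x) && e.mulFree
  | store _ i e => i.mulFree && e.mulFree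
  | query x _ _ => decide (3 ≤ x)
  | seq c₁ c₂ => c₁.tame && c₂.tame
  | cond e c₁ c₂ => e.mulFree && c₁.tame && c₂.tame
  | forLt x b c => decide (3 ≤ x) && decide (b ≤ 2) && decide (x ∉ c.wvars) && c.tame

@[simp] theorem Store.setVar_var_self (s : Store) (x : ℕ) (v : ℤ) : (s.setVar x v).var x = v := by
  simp [Store.setVar]

theorem Store.setVar_var_of_ne {x y : ℕ} (h : y ≠ x) (s : Store) (v : ℤ) :
    (s.setVar x v).var y = s.var y := by
  simp [Store.setVar, h]

@[simp] theorem Store.setVar_arr (s : Store) (x : ℕ) (v : ℤ) : (s.setVar x v).arr = s.arr := rfl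

@[simp] theorem Store.setArr_var (s : Store) (a : ℕ) (i v : ℤ) : (s.setArr a i v).var = s.var := rfl

@[simp] theorem Store.setArr_arr_self (s : Store) (a : ℕ) (i v : ℤ) :
    (s.setArr a i v).arr a = Function.update (s.arr a) i v := by
  simp [Store.setArr]

theorem Store.setArr_arr_of_ne {a b : ℕ} (h : b ≠ a) (s : Store) (i v : ℤ) :
    (s.setArr a i v).arr b = s.arr b := by
  simp [Store.setArr, h]

theorem Store.var_setVar (s : Store) (x y : ℕ) (v : ℤ) :
    (s.setVar x v).var y = if y = x then v else s.var y := by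
  simp [Store.setVar, Function.update_apply]

theorem Store.arr_setArr (s : Store) (a b : ℕ) (i v : ℤ) :
    (s.setArr a i v).arr b = if b = a then Function.update (s.arr b) i v else s.arr b := by
  by_cases h : b = a
  · subst h; simp
  · simp [Store.setArr_arr_of_ne h, h]

theorem eval_le_add_le_ne_zero (s : Store) (e₁ e₂ e₃ e₄ : Expr) :
    (Expr.add (.le e₁ e₂) (.le e₃ e₄)).eval s ≠ 0 ↔
      e₁.eval s ≤ e₂.eval s ∨ e₃.eval s ≤ e₄.eval s := by
  simp only [Expr.eval]
  split_ifs <;> simp_all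

theorem Cmd.exec_skip {d : ℕ} (O : (Fin d → ℤ) → (Fin d → ℤ) → Prop) (s : Store) :
    Cmd.skip.exec O s = s := rfl

theorem Cmd.exec_assign {d : ℕ} (O : (Fin d → ℤ) → (Fin d → ℤ) → Prop) (x : ℕ) (e : Expr)
    (s : Store) : (Cmd.assign x e).exec O s = s.setVar x (e.eval s) := rfl

theorem Cmd.exec_store {d : ℕ} (O : (Fin d → ℤ) → (Fin d → ℤ) → Prop) (a : ℕ) (i e : Expr)
    (s : Store) : (Cmd.store a i e).exec O s = s.setArr a (i.eval s) (e.eval s) := rfl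

theorem Cmd.exec_seq {d : ℕ} (O : (Fin d → ℤ) → (Fin d → ℤ) → Prop) (c₁ c₂ : Cmd) (s : Store) :
    (Cmd.seq c₁ c₂).exec O s = c₂.exec O (c₁.exec O s) := rfl

theorem Cmd.exec_cond_of_ne {d : ℕ} (O : (Fin d → ℤ) → (Fin d → ℤ) → Prop) {e : Expr} {s : Store}
    (h : e.eval s ≠ 0) (c₁ c₂ : Cmd) : (Cmd.cond e c₁ c₂).exec O s = c₁.exec O s :=
  if_pos h

theorem Cmd.exec_cond_of_eq {d : ℕ} (O : (Fin d → ℤ) → (Fin d → ℤ) → Prop) {e : Expr} {s : Store}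
    (h : e.eval s = 0) (c₁ c₂ : Cmd) : (Cmd.cond e c₁ c₂).exec O s = c₂.exec O s :=
  if_neg (not_not.2 h)

namespace Cmd

variable {d : ℕ} (O : (Fin d → ℤ) → (Fin d → ℤ) → Prop)

theorem iter_var {f : Store → Store} {x y : ℕ} (hxy : y ≠ x) (s : Store)
    (hf : ∀ s, (f s).var y = s.var y) (m : ℕ) : (iter x f s m).var y = s.var y := by
  induction m with
  | zero => exact Store.setVar_var_of_ne hxy _ _
  | succ m ih => rw [iter, Store.setVar_var_of_ne hxy, hf, ih]

theorem iter_arr {f : Store → Store} (x : ℕ) {a : ℕ} (s : Store)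
    (hf : ∀ s, (f s).arr a = s.arr a) (m : ℕ) : (iter x f s m).arr a = s.arr a := by
  induction m with
  | zero => rfl
  | succ m ih => rw [iter, Store.setVar_arr, hf, ih]

theorem exec_var_of_notMem {c : Cmd} {y : ℕ} (h : y ∉ c.wvars) (s : Store) :
    (c.exec O s).var y = s.var y := by
  induction c generalizing s with
  | skip => rfl
  | assign x e => exact Store.setVar_var_of_ne (by simpa [wvars] using h) _ _
  | store a i e => rfl
  | query x a b => exact Store.setVar_var_of_ne (by simpa [wvars] using h) _ _
  | seq c₁ c₂ ih₁ ih₂ =>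
    simp only [wvars, List.mem_append, not_or] at h
    rw [exec, ih₂ h.2, ih₁ h.1]
  | cond e c₁ c₂ ih₁ ih₂ =>
    simp only [wvars, List.mem_append, not_or] at h
    rw [exec]
    split
    · exact ih₁ h.1 s
    · exact ih₂ h.2 s
  | forLt x b c ih =>
    simp only [wvars, List.mem_cons, not_or] at h
    exact iter_var h.1 s (ih h.2) _

theorem exec_arr_of_notMem {c : Cmd} {a : ℕ} (h : a ∉ c.warrs) (s : Store) :
    (c.exec O s).arr a = s.arr a := by
  induction c generalizing s with
  | skip => rfl
  | assign x e => rfl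
  | store b i e => exact Store.setArr_arr_of_ne (by simpa [warrs] using h) _ _ _
  | query x a b => rfl
  | seq c₁ c₂ ih₁ ih₂ =>
    simp only [warrs, List.mem_append, not_or] at h
    rw [exec, ih₂ h.2, ih₁ h.1]
  | cond e c₁ c₂ ih₁ ih₂ =>
    simp only [warrs, List.mem_append, not_or] at h
    rw [exec]
    split
    · exact ih₁ h.1 s
    · exact ih₂ h.2 s
  | forLt x b c ih => exact iter_arr x s (ih h) _

/-- The invariant rule for loops. The body may use that whatever it never writes still has its
value from before the loop. -/
theorem exec_forLt {x b : ℕ} {c : Cmd} {s : Store} (Inv : ℕ → Store → Prop)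
    (h0 : Inv 0 (s.setVar x 0))
    (hstep : ∀ (m : ℕ) (s' : Store), (m : ℤ) < s.var b → s'.var x = m →
      (∀ y, y ∉ (forLt x b c).wvars → s'.var y = s.var y) →
      (∀ a, a ∉ (forLt x b c).warrs → s'.arr a = s.arr a) →
      Inv m s' → Inv (m + 1) ((c.exec O s').setVar x (m + 1))) :
    Inv (s.var b).toNat ((forLt x b c).exec O s) := by
  suffices H : ∀ m : ℕ, m ≤ (s.var b).toNat →
      Inv m (iter x (c.exec O) s m) ∧ (iter x (c.exec O) s m).var x = m from
    (H _ le_rfl).1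
  intro m
  induction m with
  | zero => intro _; exact ⟨h0, by simp [iter]⟩
  | succ m ih =>
    intro hm
    obtain ⟨ih₁, ih₂⟩ := ih (by omega)
    refine ⟨hstep m _ (by omega) ih₂ (fun y hy => ?_) (fun a ha => ?_) ih₁, by simp [iter]⟩
    · simp only [wvars, List.mem_cons, not_or] at hy
      exact iter_var hy.1 s (fun s => exec_var_of_notMem O hy.2 s) m
    · exact iter_arr x s (fun s => exec_arr_of_notMem (c := c) O ha s) m

end Cmd

/-! ### Running time of bounded programs -/

/-- Every integer in memory has bit length at most `B`. -/
def Store.Bounded (s : Store) (B : ℕ) : Prop :=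
  (∀ x, (s.var x).natAbs.size ≤ B) ∧ ∀ a i, (s.arr a i).natAbs.size ≤ B

/-- The variables that bound the loops of a tame program are at most `L`. -/
def Store.LoopBound (s : Store) (L : ℕ) : Prop :=
  ∀ x ≤ 2, s.var x ≤ L

theorem Store.Bounded.mono {s : Store} {B B' : ℕ} (h : s.Bounded B) (hB : B ≤ B') :
    s.Bounded B' :=
  ⟨fun x => (h.1 x).trans hB, fun a i => (h.2 a i).trans hB⟩

theorem Store.Bounded.setVar {s : Store} {B : ℕ} (h : s.Bounded B) (x : ℕ) {v : ℤ}
    (hv : v.natAbs.size ≤ B) : (s.setVar x v).Bounded B := by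
  refine ⟨fun y => ?_, h.2⟩
  by_cases hy : y = x
  · subst hy; simpa using hv
  · rw [Store.setVar_var_of_ne hy]; exact h.1 y

theorem Store.Bounded.setArr {s : Store} {B : ℕ} (h : s.Bounded B) (a : ℕ) (i : ℤ) {v : ℤ}
    (hv : v.natAbs.size ≤ B) : (s.setArr a i v).Bounded B := by
  refine ⟨h.1, fun b j => ?_⟩
  by_cases hb : b = a
  · subst hb
    rw [Store.setArr_arr_self]
    by_cases hj : j = i
    · subst hj; simpa using hv
    · rw [Function.update_of_ne hj]; exact h.2 b j
  · rw [Store.setArr_arr_of_ne hb]; exact h.2 b j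

theorem size_natAbs_add_le {a b : ℤ} {B : ℕ} (ha : a.natAbs.size ≤ B) (hb : b.natAbs.size ≤ B) :
    (a + b).natAbs.size ≤ B + 1 := by
  rw [Nat.size_le] at *
  have := Int.natAbs_add_le a b
  rw [pow_succ]
  omega

theorem size_natAbs_sub_le {a b : ℤ} {B : ℕ} (ha : a.natAbs.size ≤ B) (hb : b.natAbs.size ≤ B) :
    (a - b).natAbs.size ≤ B + 1 := by
  rw [sub_eq_add_neg]
  exact size_natAbs_add_le ha (by simpa using hb)

/-- Without multiplication, bit lengths grow by an additive constant that depends on the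
expression only. -/
theorem Expr.exists_size_cost_le (e : Expr) (he : e.mulFree = true) :
    ∃ K : ℕ, ∀ (s : Store) (B : ℕ), s.Bounded B →
      (e.eval s).natAbs.size ≤ B + K ∧ e.cost s ≤ K * (B + K) := by
  induction e with
  | const c =>
    refine ⟨c.natAbs.size + 1, fun s B _ => ⟨by simp only [Expr.eval]; omega, ?_⟩⟩
    simp only [Expr.cost, bitCost]
    nlinarith
  | var x =>
    refine ⟨1, fun s B hs => ?_⟩
    have := hs.1 x
    simp only [Expr.eval, Expr.cost, bitCost]
    omega
  | read a i ih =>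
    obtain ⟨K, hK⟩ := ih he
    refine ⟨K + 1, fun s B hs => ?_⟩
    have h1 := hs.2 a (i.eval s)
    obtain ⟨h2, h3⟩ := hK s B hs
    simp only [Expr.eval, Expr.cost, bitCost]
    refine ⟨by omega, by nlinarith⟩
  | add e₁ e₂ ih₁ ih₂ =>
    simp only [Expr.mulFree, Bool.and_eq_true] at he
    obtain ⟨K₁, h₁⟩ := ih₁ he.1
    obtain ⟨K₂, h₂⟩ := ih₂ he.2
    refine ⟨K₁ + K₂ + 2, fun s B hs => ?_⟩
    obtain ⟨h3, h4⟩ := h₁ s B hs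
    obtain ⟨h5, h6⟩ := h₂ s B hs
    have h7 := size_natAbs_add_le (h3.trans (show _ ≤ B + (K₁ + K₂) by omega))
      (h5.trans (show _ ≤ B + (K₁ + K₂) by omega))
    simp only [Expr.eval, Expr.cost, bitCost]
    refine ⟨by omega, by nlinarith⟩
  | sub e₁ e₂ ih₁ ih₂ =>
    simp only [Expr.mulFree, Bool.and_eq_true] at he
    obtain ⟨K₁, h₁⟩ := ih₁ he.1
    obtain ⟨K₂, h₂⟩ := ih₂ he.2
    refine ⟨K₁ + K₂ + 2, fun s B hs => ?_⟩
    obtain ⟨h3, h4⟩ := h₁ s B hs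
    obtain ⟨h5, h6⟩ := h₂ s B hs
    have h7 := size_natAbs_sub_le (h3.trans (show _ ≤ B + (K₁ + K₂) by omega))
      (h5.trans (show _ ≤ B + (K₁ + K₂) by omega))
    simp only [Expr.eval, Expr.cost, bitCost]
    refine ⟨by omega, by nlinarith⟩
  | mul => simp [Expr.mulFree] at he
  | le e₁ e₂ ih₁ ih₂ =>
    simp only [Expr.mulFree, Bool.and_eq_true] at he
    obtain ⟨K₁, h₁⟩ := ih₁ he.1
    obtain ⟨K₂, h₂⟩ := ih₂ he.2
    refine ⟨K₁ + K₂ + 1, fun s B hs => ?_⟩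
    obtain ⟨-, h4⟩ := h₁ s B hs
    obtain ⟨-, h6⟩ := h₂ s B hs
    simp only [Expr.eval, Expr.cost]
    refine ⟨?_, by nlinarith⟩
    split
    · simp only [Int.natAbs_one, Nat.size_one]; omega
    · simp

theorem eval_nat_mono (P : Polynomial ℕ) {a b : ℕ} (h : a ≤ b) : P.eval a ≤ P.eval b := by
  rw [Polynomial.eval_eq_sum, Polynomial.eval_eq_sum]
  exact Finset.sum_le_sum fun i _ => Nat.mul_le_mul_left _ (Nat.pow_le_pow_left h i)

theorem queryCost_le {d : ℕ} {s : Store} {B : ℕ} (hs : s.Bounded B) (a b : ℕ) :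
    queryCost (s.vec d a) (s.vec d b) ≤ 1 + d * (2 * B + 2) := by
  unfold queryCost
  have : ∑ k : Fin d, (bitCost (s.vec d a k) + bitCost (s.vec d b k))
      ≤ ∑ _k : Fin d, (2 * B + 2) := by
    refine Finset.sum_le_sum fun k _ => ?_
    have h1 := hs.2 a ((k : ℕ) : ℤ)
    have h2 := hs.2 b ((k : ℕ) : ℤ)
    simp only [bitCost, Store.vec]
    omega
  simp only [Finset.sum_const, Finset.card_univ, Fintype.card_fin, smul_eq_mul] at this
  omega

namespace Cmd

theorem tame_notMem_wvars {c : Cmd} (hc : c.tame = true) {y : ℕ} (hy : y ≤ 2) : y ∉ c.wvars := by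
  induction c with
  | skip => simp [wvars]
  | assign x e => simp [tame] at hc; simp [wvars]; omega
  | store a i e => simp [wvars]
  | query x a b => simp [tame] at hc; simp [wvars]; omega
  | seq c₁ c₂ ih₁ ih₂ =>
    simp only [tame, Bool.and_eq_true] at hc
    simp [wvars, ih₁ hc.1, ih₂ hc.2]
  | cond e c₁ c₂ ih₁ ih₂ =>
    simp only [tame, Bool.and_eq_true] at hc
    simp [wvars, ih₁ hc.1.2, ih₂ hc.2]
  | forLt x b c ih =>
    simp only [tame, Bool.and_eq_true, decide_eq_true_eq] at hc
    simp only [wvars, List.mem_cons, not_or]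
    exact ⟨by omega, ih hc.2⟩

theorem loopBound_exec {d : ℕ} (O : (Fin d → ℤ) → (Fin d → ℤ) → Prop) {c : Cmd}
    (hc : c.tame = true) {s : Store} {L : ℕ} (hs : s.LoopBound L) : (c.exec O s).LoopBound L := by
  intro x hx
  rw [exec_var_of_notMem O (tame_notMem_wvars hc hx)]
  exact hs x hx

/-- From any point of the loop, the compiled loop runs to the state `iter x f s N`. -/
theorem run_loop {d : ℕ} {O : (Fin d → ℤ) → (Fin d → ℤ) → Prop} {x b : ℕ} {c : Cmd} {s : Store}
    (hxb : b ≠ x) (hx : x ∉ c.wvars) (hb : b ∉ c.wvars) {T B : ℕ}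
    (hB : ∀ m ≤ (s.var b).toNat, (iter x (c.exec O) s m).Bounded B)
    (hT : ∀ m < (s.var b).toNat,
      ∃ t ≤ T, Run O c.compile (iter x (c.exec O) s m) (c.exec O (iter x (c.exec O) s m)) t)
    (k : ℕ) : ∀ m, m + k = (s.var b).toNat →
      ∃ t ≤ (k + 1) * (T + 9 * B + 30),
        Run O (.loop (.le (.add (.var x) (.const 1)) (.var b))
          (.seq c.compile (.assign x (.add (.var x) (.const 1)))))
          (iter x (c.exec O) s m) (iter x (c.exec O) s (s.var b).toNat) t := by
  have hsb : ∀ m, (iter x (c.exec O) s m).var b = s.var b := fun m =>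
    iter_var hxb s (fun s => exec_var_of_notMem O hb s) m
  have hsx : ∀ m, (iter x (c.exec O) s m).var x = m := by
    intro m; cases m <;> simp [iter]
  have h1 : bitCost 1 = 2 := by simp [bitCost]
  have hcost : ∀ s : Store, s.Bounded B →
      (Expr.le (.add (.var x) (.const 1)) (.var b)).cost s ≤ 3 * B + 10 ∧
      (Expr.add (.var x) (.const 1)).cost s ≤ 2 * B + 10 := by
    intro s hs
    have h2 := hs.1 x
    have h3 := hs.1 b
    have h4 := size_natAbs_add_le (B := B + 1) (h2.trans (Nat.le_succ B))
      (show (1 : ℤ).natAbs.size ≤ B + 1 by simp)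
    simp only [Expr.cost, Expr.eval, h1]
    simp only [bitCost]
    omega
  induction k with
  | zero =>
    intro m hm
    rw [add_zero] at hm
    subst hm
    refine ⟨_, ?_, Run.loop_false ?_⟩
    · have := (hcost _ (hB _ le_rfl)).1
      omega
    · simp only [Expr.eval, hsb, hsx]
      rw [if_neg]
      omega
  | succ k ih =>
    intro m hm
    obtain ⟨t₂, ht₂, hr₂⟩ := ih (m + 1) (by omega)
    obtain ⟨t₁, ht₁, hr₁⟩ := hT m (by omega)
    have hx' : (c.exec O (iter x (c.exec O) s m)).var x = m := by
      rw [exec_var_of_notMem O hx, hsx]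
    have hr₃ := Run.assign (O := O) x (.add (.var x) (.const 1))
      (c.exec O (iter x (c.exec O) s m))
    have he : Expr.eval (c.exec O (iter x (c.exec O) s m)) (.add (.var x) (.const 1))
        = (m : ℤ) + 1 := by
      simp [Expr.eval, hx']
    rw [he] at hr₃
    refine ⟨_, ?_, Run.loop_true ?_ (Run.seq hr₁ hr₃) hr₂⟩
    · have h2 := (hcost _ (hB m (by omega))).1
      have h3 : (Expr.add (.var x) (.const 1)).cost (c.exec O (iter x (c.exec O) s m))
          ≤ 2 * B + 10 := by
        have := (hcost _ (hB m (by omega))).2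
        simpa only [Expr.cost, Expr.eval, hsx, hx'] using this
      calc _ ≤ 1 + (3 * B + 10) + (T + (1 + (2 * B + 10))) + (k + 1) * (T + 9 * B + 30) := by
            gcongr
        _ ≤ _ := by ring_nf; omega
    · simp only [Expr.eval, hsb, hsx]
      rw [if_pos (by omega)]
      exact one_ne_zero

/-- Tame programs halt in polynomial time, since every loop bound is an input parameter and
every operation lengthens the numbers in memory by at most a constant. -/
theorem exists_run (c : Cmd) (hc : c.tame = true) :
    ∃ G P : Polynomial ℕ, ∀ (d : ℕ) (O : (Fin d → ℤ) → (Fin d → ℤ) → Prop) (s : Store) (L B : ℕ),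
      d ≤ L → s.LoopBound L → s.Bounded B →
        (c.exec O s).Bounded (B + G.eval L) ∧
        ∃ t ≤ P.eval (L + B), Run O c.compile s (c.exec O s) t := by
  classical
  induction c with
  | skip => exact ⟨0, 1, fun d O s L B _ _ hB => ⟨by simpa [exec] using hB, 1, by simp, Run.skip s⟩⟩
  | assign x e =>
    simp only [tame, Bool.and_eq_true] at hc
    obtain ⟨K, hK⟩ := e.exists_size_cost_le hc.2
    refine ⟨.C K, .C 1 + .C K * (.X + .C K), fun d O s L B _ _ hB => ?_⟩
    obtain ⟨h1, h2⟩ := hK s B hB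
    refine ⟨?_, _, ?_, Run.assign x e s⟩
    · simpa [exec] using (hB.mono (Nat.le_add_right B K)).setVar x h1
    · simp only [Polynomial.eval_add, Polynomial.eval_mul, Polynomial.eval_C, Polynomial.eval_X]
      have : K * (B + K) ≤ K * (L + B + K) := Nat.mul_le_mul_left _ (by omega)
      omega
  | store a i e =>
    simp only [tame, Bool.and_eq_true] at hc
    obtain ⟨K, hK⟩ := e.exists_size_cost_le hc.2
    obtain ⟨K', hK'⟩ := i.exists_size_cost_le hc.1
    refine ⟨.C K, .C 1 + .C K' * (.X + .C K') + .C K * (.X + .C K), fun d O s L B _ _ hB => ?_⟩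
    obtain ⟨h1, h2⟩ := hK s B hB
    obtain ⟨-, h3⟩ := hK' s B hB
    refine ⟨?_, _, ?_, Run.store a i e s⟩
    · simpa [exec] using (hB.mono (Nat.le_add_right B K)).setArr a _ h1
    · simp only [Polynomial.eval_add, Polynomial.eval_mul, Polynomial.eval_C, Polynomial.eval_X]
      have : K * (B + K) ≤ K * (L + B + K) := Nat.mul_le_mul_left _ (by omega)
      have : K' * (B + K') ≤ K' * (L + B + K') := Nat.mul_le_mul_left _ (by omega)
      omega
  | query x a b =>
    refine ⟨.C 1, .C 2 + .X * (.C 2 * .X + .C 2), fun d O s L B hd _ hB => ⟨?_, ?_⟩⟩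
    · refine (hB.mono (Nat.le_add_right B _)).setVar x ?_
      simp only [Polynomial.eval_C]
      split <;> simp
    · refine ⟨1 + queryCost (s.vec d a) (s.vec d b), ?_, ?_⟩
      · simp only [Polynomial.eval_add, Polynomial.eval_mul, Polynomial.eval_C, Polynomial.eval_X]
        have := queryCost_le (d := d) hB a b
        have : d * (2 * B + 2) ≤ (L + B) * (2 * (L + B) + 2) :=
          Nat.mul_le_mul (by omega) (by omega)
        omega
      · by_cases h : O (s.vec d a) (s.vec d b)
        · simpa only [exec, compile, if_pos h] using Run.query_true x a b s h
        · simpa only [exec, compile, if_neg h] using Run.query_false x a b s h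
  | seq c₁ c₂ ih₁ ih₂ =>
    simp only [tame, Bool.and_eq_true] at hc
    obtain ⟨G₁, P₁, h₁⟩ := ih₁ hc.1
    obtain ⟨G₂, P₂, h₂⟩ := ih₂ hc.2
    refine ⟨G₁ + G₂, P₁ + P₂.comp (.X + G₁), fun d O s L B hd hL hB => ?_⟩
    obtain ⟨hB₁, t₁, ht₁, hr₁⟩ := h₁ d O s L B hd hL hB
    obtain ⟨hB₂, t₂, ht₂, hr₂⟩ := h₂ d O _ L _ hd (loopBound_exec O hc.1 hL) hB₁
    refine ⟨by simpa [exec, add_assoc] using hB₂, _, ?_, Run.seq hr₁ hr₂⟩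
    simp only [Polynomial.eval_add, Polynomial.eval_comp, Polynomial.eval_X]
    have h3 := eval_nat_mono G₁ (show L ≤ L + B by omega)
    have h4 := eval_nat_mono P₂
      (show L + (B + G₁.eval L) ≤ L + B + G₁.eval (L + B) by omega)
    omega
  | cond e c₁ c₂ ih₁ ih₂ =>
    simp only [tame, Bool.and_eq_true] at hc
    obtain ⟨K, hK⟩ := e.exists_size_cost_le hc.1.1
    obtain ⟨G₁, P₁, h₁⟩ := ih₁ hc.1.2
    obtain ⟨G₂, P₂, h₂⟩ := ih₂ hc.2
    refine ⟨G₁ + G₂, .C 1 + .C K * (.X + .C K) + P₁ + P₂, fun d O s L B hd hL hB => ?_⟩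
    obtain ⟨hB₁, t₁, ht₁, hr₁⟩ := h₁ d O s L B hd hL hB
    obtain ⟨hB₂, t₂, ht₂, hr₂⟩ := h₂ d O s L B hd hL hB
    obtain ⟨-, h3⟩ := hK s B hB
    have : K * (B + K) ≤ K * (L + B + K) := Nat.mul_le_mul_left _ (by omega)
    simp only [Polynomial.eval_add, Polynomial.eval_mul, Polynomial.eval_C, Polynomial.eval_X]
    by_cases he : e.eval s = 0
    · simp only [exec, he, ne_eq, not_true_eq_false, if_false]
      exact ⟨hB₂.mono (by omega), _, by omega, Run.cond_false he hr₂⟩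
    · simp only [exec, he, ne_eq, not_false_eq_true, if_true]
      exact ⟨hB₁.mono (by omega), _, by omega, Run.cond_true he hr₁⟩
  | forLt x b c ih =>
    simp only [tame, Bool.and_eq_true, decide_eq_true_eq] at hc
    obtain ⟨⟨⟨hx3, hb2⟩, hxc⟩, hc⟩ := hc
    obtain ⟨G, P, h⟩ := ih hc
    refine ⟨.X + .X * G, .C 4 + (.X + .C 1) * (P.comp (.X + (.X + .X * G))
      + .C 9 * (.X + (.X + .X * G)) + .C 30), fun d O s L B hd hL hB => ?_⟩
    have hbc := tame_notMem_wvars hc hb2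
    have hN : (s.var b).toNat ≤ L := by have := hL b hb2; omega
    have hloop : ∀ m, (iter x (c.exec O) s m).LoopBound L := by
      intro m y hy
      rw [iter_var (by omega) s fun s => exec_var_of_notMem O (tame_notMem_wvars hc hy) s]
      exact hL y hy
    have hsmall : ∀ m ≤ L, (m : ℤ).natAbs.size ≤ L := by
      intro m hm
      rw [Nat.size_le, Int.natAbs_natCast]
      exact hm.trans_lt Nat.lt_two_pow_self
    -- The counter has at most `L` bits, and each round adds at most `G.eval L` bits.
    have hbd : ∀ m ≤ L, (iter x (c.exec O) s m).Bounded (B + L + m * G.eval L) := by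
      intro m
      induction m with
      | zero => intro _; exact (hB.mono (by omega)).setVar x (by simp)
      | succ m ihm =>
        intro hm
        have h1 := (h d O _ L _ hd (hloop m) (ihm (by omega))).1
        have h2 := hsmall (m + 1) hm
        refine (h1.mono (by rw [add_mul]; omega)).setVar x ?_
        push_cast at h2
        omega
    have hbd' : ∀ m ≤ L, (iter x (c.exec O) s m).Bounded (B + (L + L * G.eval L)) := by
      intro m hm
      refine (hbd m hm).mono ?_
      have := Nat.mul_le_mul_right (G.eval L) hm
      omega
    simp only [Polynomial.eval_add, Polynomial.eval_mul, Polynomial.eval_C, Polynomial.eval_X,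
      Polynomial.eval_comp]
    refine ⟨hbd' _ hN, ?_⟩
    obtain ⟨t, ht, hr⟩ := run_loop (T := P.eval (L + (B + (L + L * G.eval L)))) (O := O)
      (s := s) (show b ≠ x by omega) hxc hbc
      (fun m hm => hbd' m (hm.trans hN))
      (fun m hm => (h d O _ L _ hd (hloop m) (hbd' m (hm.le.trans hN))).2)
      (s.var b).toNat 0 (by omega)
    refine ⟨_, ?_, Run.seq (Run.assign x (.const 0) s) hr⟩
    have hG := eval_nat_mono G (show L ≤ L + B by omega)
    have hX : L + (B + (L + L * G.eval L)) ≤ L + B + (L + B + (L + B) * G.eval (L + B)) := by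
      have := Nat.mul_le_mul (show L ≤ L + B by omega) hG
      omega
    have hP := eval_nat_mono P hX
    have : (Expr.const 0).cost s = 1 := by simp [Expr.cost, bitCost]
    rw [this]
    have h5 : ((s.var b).toNat + 1) * (P.eval (L + (B + (L + L * G.eval L)))
          + 9 * (B + (L + L * G.eval L)) + 30)
        ≤ (L + B + 1) * (P.eval (L + B + (L + B + (L + B) * G.eval (L + B)))
          + 9 * (L + B + (L + B + (L + B) * G.eval (L + B))) + 30) :=
      Nat.mul_le_mul (by omega) (by omega)
    omega

end Cmd

end OracleRAM

/-! ### The approximation guarantee and linear programming duality -/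

namespace NonlinearMatching

theorem proj_permMatrix {d n : ℕ} (w : Fin d → Matrix (Fin n) (Fin n) ℕ)
    (σ : Equiv.Perm (Fin n)) (k : Fin d) :
    proj w (σ.permMatrix ℝ) k = ∑ i, (w k i (σ i) : ℝ) := by
  simp [proj, Equiv.Perm.permMatrix, PEquiv.toMatrix_apply, eq_comm]

theorem lpNorm_nonneg {p : ℝ≥0∞} (hp : 1 ≤ p) {d : ℕ} (y : Fin d → ℝ) : 0 ≤ lpNorm p y := by
  have : Fact (1 ≤ p) := ⟨hp⟩
  exact norm_nonneg _

theorem lpNorm_zero {p : ℝ≥0∞} (hp : 1 ≤ p) {d : ℕ} : lpNorm p (fun _ : Fin d => (0 : ℝ)) = 0 := by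
  have : Fact (1 ≤ p) := ⟨hp⟩
  exact norm_zero (E := PiLp p (fun _ : Fin d => ℝ))

theorem abs_le_lpNorm {p : ℝ≥0∞} (hp : 1 ≤ p) {d : ℕ} (y : Fin d → ℝ) (k : Fin d) :
    |y k| ≤ lpNorm p y := by
  have : Fact (1 ≤ p) := ⟨hp⟩
  exact PiLp.norm_apply_le (WithLp.toLp p y : PiLp p (fun _ : Fin d => ℝ)) k

/-- The `l_p` norm is at most `d ^ (1 / p)` times the maximum norm. -/
theorem lpNorm_le_of_abs_le {p : ℝ≥0∞} (hp : 1 ≤ p) {d : ℕ} (y : Fin d → ℝ) {M : ℝ} (hM : 0 ≤ M)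
    (h : ∀ k, |y k| ≤ M) : lpNorm p y ≤ (d : ℝ) ^ (1 / p).toReal * M := by
  have : Fact (1 ≤ p) := ⟨hp⟩
  have h1 := (PiLp.antilipschitzWith_ofLp p (fun _ : Fin d => ℝ)).le_mul_dist
    (WithLp.toLp p y) (WithLp.toLp p 0)
  have h2 : ‖y‖ ≤ M := (pi_norm_le_iff_of_nonneg hM).2 h
  simp only [WithLp.toLp_zero, dist_zero_right, Fintype.card_fin] at h1
  refine h1.trans ?_
  push_cast
  gcongr

/-- The objective value of a matching is at most `d ^ (1 / p)` times its largest coordinate, which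
no matching can make larger than the corresponding linear maximizer does. -/
theorem IsBestOfLinearMaximizers.isApproximative {d n : ℕ} (hd : 0 < d) {p : ℝ≥0∞} (hp : 1 ≤ p)
    {w : Fin d → Matrix (Fin n) (Fin n) ℕ} {σ : Equiv.Perm (Fin n)}
    (h : IsBestOfLinearMaximizers p w σ) :
    IsApproximative (objective p w) ((d : ℝ) ^ (1 / p).toReal) σ ∧
      (p = ∞ → IsOptimal (objective p w) σ) := by
  obtain ⟨τ, hτ, r, hr, rfl⟩ := h
  have hσ : 0 ≤ objective p w (τ r) := lpNorm_nonneg hp _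
  have hone : (1 : ℝ) ≤ (d : ℝ) ^ (1 / p).toReal :=
    Real.one_le_rpow (by exact_mod_cast hd) ENNReal.toReal_nonneg
  have key : ∀ s, objective p w s ≤ (d : ℝ) ^ (1 / p).toReal * objective p w (τ r) := by
    intro s
    refine lpNorm_le_of_abs_le hp _ hσ fun k => ?_
    have h0 : 0 ≤ proj w (s.permMatrix ℝ) k := by
      rw [proj_permMatrix]; positivity
    rw [abs_of_nonneg h0]
    calc proj w (s.permMatrix ℝ) k ≤ proj w ((τ k).permMatrix ℝ) k :=
          hτ k _ permMatrix_mem_doublyStochastic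
      _ ≤ |proj w ((τ k).permMatrix ℝ) k| := le_abs_self _
      _ ≤ objective p w (τ k) := abs_le_lpNorm hp _ k
      _ ≤ _ := hr k
  refine ⟨?_, ?_⟩
  · obtain ⟨s, hs⟩ := Finite.exists_max (objective p w)
    refine ⟨s, hs, ?_, ?_⟩
    · rw [one_div, inv_mul_le_iff₀ (by positivity)]
      exact key s
    · have h0 : 0 ≤ objective p w s := lpNorm_nonneg hp _
      exact (hs _).trans (le_mul_of_one_le_left h0 hone)
  · rintro rfl s
    simpa using key s

/-- Weak linear programming duality for the Birkhoff polytope: a matching all of whose edges are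
tight for a feasible dual solution `u, v` is optimal. -/
theorem proj_le_of_dual {d n : ℕ} {w : Fin d → Matrix (Fin n) (Fin n) ℕ} {k : Fin d}
    {σ : Equiv.Perm (Fin n)} {u v : Fin n → ℤ} (h : ∀ i j, (w k i j : ℤ) ≤ u i + v j)
    (hσ : ∀ i, u i + v (σ i) = w k i (σ i)) {x : Matrix (Fin n) (Fin n) ℝ}
    (hx : x ∈ doublyStochastic ℝ (Fin n)) : proj w x k ≤ proj w (σ.permMatrix ℝ) k := by
  rw [proj_permMatrix]
  obtain ⟨h0, hrow, hcol⟩ := mem_doublyStochastic_iff_sum.1 hx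
  calc proj w x k ≤ ∑ i, ∑ j, ((u i : ℝ) + v j) * x i j := by
        refine Finset.sum_le_sum fun i _ => Finset.sum_le_sum fun j _ => ?_
        refine mul_le_mul_of_nonneg_right ?_ (h0 i j)
        exact_mod_cast h i j
    _ = ∑ i, (u i : ℝ) + ∑ j, (v j : ℝ) := by
        simp only [add_mul, Finset.sum_add_distrib, ← Finset.mul_sum, hrow, mul_one]
        rw [Finset.sum_comm]
        simp only [← Finset.mul_sum, hcol, mul_one]
    _ = ∑ i, ((u i : ℝ) + v (σ i)) := by
        rw [Finset.sum_add_distrib, Equiv.sum_comp σ fun j => (v j : ℝ)]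
    _ = ∑ i, (w k i (σ i) : ℝ) := Finset.sum_congr rfl fun i _ => by exact_mod_cast hσ i

end NonlinearMatching

namespace Hungarian

open OracleRAM NonlinearMatching

open Cmd (exec exec_forLt exec_cond_of_ne exec_cond_of_eq exec_skip exec_assign exec_store
  exec_seq)

/-! ### Alternating trees -/

/-- `u, v` is a feasible dual solution for the `n × n` weights `g`. -/
def Feasible (n : ℤ) (g : ℤ → ℤ → ℤ) (u v : ℤ → ℤ) : Prop :=
  ∀ i j, 0 ≤ i → i < n → 0 ≤ j → j < n → g i j ≤ u i + v j

/-- Disregarding the column `h`, the array `p` matches each of the rows `0, …, r - 1` to exactly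
one of the columns `0, …, n`; it holds the row of each matched column and `-1` at each free
column. The column `n` is an artificial one. -/
structure Matching (n r h : ℤ) (p : ℤ → ℤ) : Prop where
  range : ∀ j, 0 ≤ j → j ≤ n → j ≠ h → -1 ≤ p j ∧ p j < r
  inj : ∀ j j', 0 ≤ j → j ≤ n → j ≠ h → 0 ≤ j' → j' ≤ n → j' ≠ h → 0 ≤ p j → p j = p j' → j = j'
  surj : ∀ i, 0 ≤ i → i < r → ∃ j, 0 ≤ j ∧ j ≤ n ∧ j ≠ h ∧ p j = i

/-- The matched edges are tight, except possibly those at the columns `h` and `n`. -/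
def Tight (n h : ℤ) (g : ℤ → ℤ → ℤ) (u v p : ℤ → ℤ) : Prop :=
  ∀ j, 0 ≤ j → j < n → j ≠ h → 0 ≤ p j → u (p j) + v j = g (p j) j

/-- An alternating tree of tight edges after `c` extensions. Its root is the row `r`, which is
provisionally matched to the artificial column `n`. The array `used` holds `0` at the columns
outside the tree and a time stamp at those in the tree, and `way j` is the column that precedes
`j` on the path from the root, so that `(p (way j), j)` is an edge of the tree. -/
structure Tree (n r c : ℤ) (g : ℤ → ℤ → ℤ) (u v p used way : ℤ → ℤ) : Prop where
  root_nonneg : 0 ≤ r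
  root_lt : r < n
  apply_root : p n = r
  matching : Matching n r n p
  feasible : Feasible n g u v
  tight : Tight n n g u v p
  used_range : ∀ j, 0 ≤ j → j ≤ n → 0 ≤ used j ∧ used j ≤ c + 1
  used_root : used n = 1
  way_spec : ∀ j, 0 ≤ j → j < n → used j ≠ 0 → 0 ≤ way j ∧ way j ≤ n ∧ 0 < used (way j) ∧
    used (way j) < used j ∧ 0 ≤ p (way j) ∧ u (p (way j)) + v j = g (p (way j)) j

/-- All columns of the tree are matched. -/
def Closed (n : ℤ) (p used : ℤ → ℤ) : Prop :=
  ∀ j, 0 ≤ j → j < n → used j ≠ 0 → 0 ≤ p j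

theorem Matching.exists_free {n r : ℤ} {p : ℤ → ℤ} (hr : 0 ≤ r) (hrn : r < n)
    (hp : Matching n r n p) : ∃ j, 0 ≤ j ∧ j < n ∧ p j = -1 := by
  by_contra! hcon
  have hmaps : ∀ j ∈ Finset.Ico 0 n, p j ∈ Finset.Ico 0 r := by
    intro j hj
    rw [Finset.mem_Ico] at *
    have := hp.range j hj.1 hj.2.le hj.2.ne
    have := hcon j hj.1 hj.2
    omega
  have hinj : ∀ j ∈ Finset.Ico 0 n, ∀ j' ∈ Finset.Ico 0 n, p j = p j' → j = j' := by
    intro j hj j' hj' hjj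
    have := hmaps j hj
    rw [Finset.mem_Ico] at *
    exact hp.inj j j' hj.1 hj.2.le hj.2.ne hj'.1 hj'.2.le hj'.2.ne this.1 hjj
  have := Finset.card_le_card_of_injOn p hmaps (fun j hj j' hj' => hinj j hj j' hj')
  simp at this
  omega

/-- The columns of the tree other than the artificial one. -/
noncomputable def treeColumns (n : ℤ) (used : ℤ → ℤ) : Finset ℤ :=
  (Finset.Ico 0 n).filter fun j => used j ≠ 0

/-- Since only `r < n` rows are matched, some column is free, and a closed tree omits it. -/
theorem lt_of_closed {n r c : ℤ} {g : ℤ → ℤ → ℤ} {u v p used way : ℤ → ℤ}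
    (T : Tree n r c g u v p used way) (hC : Closed n p used) :
    (treeColumns n used).card < n := by
  obtain ⟨j, hj0, hjn, hpj⟩ := T.matching.exists_free T.root_nonneg T.root_lt
  have hlt : (treeColumns n used).card < (Finset.Ico 0 n).card := by
    refine Finset.card_lt_card (Finset.filter_ssubset.2 ⟨j, Finset.mem_Ico.2 ⟨hj0, hjn⟩, ?_⟩)
    intro h
    have := hC j hj0 hjn h
    omega
  have hn := T.root_nonneg.trans_lt T.root_lt
  rw [Int.card_Ico] at hlt
  omega

theorem card_treeColumns_update {n j x : ℤ} {used : ℤ → ℤ} (h0 : 0 ≤ j) (hn : j < n)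
    (hj : used j = 0) (hx : x ≠ 0) :
    (treeColumns n (Function.update used j x)).card = (treeColumns n used).card + 1 := by
  have : treeColumns n (Function.update used j x) = insert j (treeColumns n used) := by
    ext i
    by_cases hi : i = j
    · subst hi; simp [treeColumns, h0, hn, hx]
    · simp [treeColumns, hi]
  rw [this, Finset.card_insert_of_notMem (by simp [treeColumns, hj])]

/-- Shifting the dual solution by the smallest slack `δ` of an edge that leaves the tree keeps it
feasible and keeps all matched edges and tree edges tight. -/
theorem Tree.dual_shift {n r c δ : ℤ} {g : ℤ → ℤ → ℤ} {u v u' v' p used way : ℤ → ℤ}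
    (T : Tree n r c g u v p used way) (hC : Closed n p used) (hδ : 0 ≤ δ)
    (hmin : ∀ j, 0 ≤ j → j ≤ n → used j ≠ 0 → ∀ j', 0 ≤ j' → j' < n → used j' = 0 →
      δ ≤ u (p j) + v j' - g (p j) j')
    (hu : ∀ j, 0 ≤ j → j ≤ n → used j ≠ 0 → u' (p j) = u (p j) - δ)
    (hu' : ∀ i, (∀ j, 0 ≤ j → j ≤ n → used j ≠ 0 → p j ≠ i) → u' i = u i)
    (hv : ∀ j, 0 ≤ j → j ≤ n → used j ≠ 0 → v' j = v j + δ)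
    (hv' : ∀ j, 0 ≤ j → j ≤ n → used j = 0 → v' j = v j) :
    Tree n r c g u' v' p used way := by
  obtain ⟨h0, hr, hroot, hp, hf, ht, hused, hur, hway⟩ := T
  refine ⟨h0, hr, hroot, hp, ?_, ?_, hused, hur, ?_⟩
  · intro i j hi hin hj hjn
    have hij := hf i j hi hin hj hjn
    by_cases hS : ∃ j, 0 ≤ j ∧ j ≤ n ∧ used j ≠ 0 ∧ p j = i
    · obtain ⟨k, hk0, hkn, hk, rfl⟩ := hS
      have h1 := hu k hk0 hkn hk
      by_cases hT : used j = 0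
      · have := hv' j hj hjn.le hT
        have := hmin k hk0 hkn hk j hj hjn hT
        omega
      · have := hv j hj hjn.le hT
        omega
    · push Not at hS
      have h1 := hu' i hS
      by_cases hT : used j = 0
      · have := hv' j hj hjn.le hT
        omega
      · have := hv j hj hjn.le hT
        omega
  · intro j hj hjn hjne hpj
    have hjt := ht j hj hjn hjne hpj
    by_cases hT : used j = 0
    · have h1 := hv' j hj hjn.le hT
      have h2 := hu' (p j) (by
        intro k hk0 hkn hk hkj
        by_cases hkn' : k = n
        · have := hp.range j hj hjn.le hjne
          subst hkn'
          omega
        · have := hp.inj k j hk0 hkn hkn' hj hjn.le hjne (by omega) hkj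
          subst this
          exact hk hT)
      omega
    · have := hv j hj hjn.le hT
      have := hu j hj hjn.le hT
      omega
  · intro j hj hjn hT
    obtain ⟨h1, h2, h3, h4, h5, h6⟩ := hway j hj hjn hT
    refine ⟨h1, h2, h3, h4, h5, ?_⟩
    have := hv j hj hjn.le hT
    have := hu (way j) h1 h2 (by omega)
    omega

/-- A tight edge that leaves the tree extends it. -/
theorem Tree.extend {n r c a b : ℤ} {g : ℤ → ℤ → ℤ} {u v p used way : ℤ → ℤ}
    (T : Tree n r c g u v p used way) (hc : 0 ≤ c) (ha0 : 0 ≤ a) (han : a ≤ n) (ha : used a ≠ 0)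
    (hpa : 0 ≤ p a) (hb0 : 0 ≤ b) (hbn : b < n) (hb : used b = 0)
    (hab : u (p a) + v b = g (p a) b) :
    Tree n r (c + 1) g u v p (Function.update used b (c + 2)) (Function.update way b a) := by
  obtain ⟨h0, hr, hroot, hp, hf, ht, hused, hur, hway⟩ := T
  have hne : a ≠ b := by rintro rfl; exact ha hb
  refine ⟨h0, hr, hroot, hp, hf, ht, ?_, ?_, ?_⟩
  · intro j hj hjn
    by_cases hjb : j = b
    · subst hjb; rw [Function.update_self]; omega
    · rw [Function.update_of_ne hjb]; have := hused j hj hjn; omega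
  · rw [Function.update_of_ne (by omega)]; exact hur
  · intro j hj hjn hT
    by_cases hjb : j = b
    · subst hjb
      have := hused a ha0 han
      rw [Function.update_self, Function.update_self, Function.update_of_ne hne]
      exact ⟨ha0, han, by omega, by omega, hpa, hab⟩
    · rw [Function.update_of_ne hjb] at hT ⊢
      rw [Function.update_of_ne hjb]
      have hw := hway j hj hjn hT
      rw [Function.update_of_ne (show way j ≠ b by rintro rfl; omega)]
      exact hw

/-- The state after some steps of the augmentation along the tree path from the free column: the
column `h` is the current end of the part of the path that is not yet exchanged. The columns that
precede `h` still have their rows in the original matching `p₀`, which the tree refers to. -/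
structure Augmenting (n r h : ℤ) (g : ℤ → ℤ → ℤ) (u v p₀ p used : ℤ → ℤ) : Prop where
  nonneg : 0 ≤ h
  le : h ≤ n
  used_ne : used h ≠ 0
  matching : Matching n (r + 1) h p
  tight : Tight n h g u v p
  unchanged : ∀ j, 0 ≤ j → j ≤ n → used j ≤ used h → p j = p₀ j

/-- Once the root row is counted as matched, a free column of the tree can serve as the hole. -/
theorem Tree.augmenting {n r c h : ℤ} {g : ℤ → ℤ → ℤ} {u v p used way : ℤ → ℤ}
    (T : Tree n r c g u v p used way) (h0 : 0 ≤ h) (hn : h < n) (hu : used h ≠ 0)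
    (hp : p h = -1) : Augmenting n r h g u v p p used := by
  obtain ⟨hr0, hrn, hroot, hm, hf, ht, hused, hur, hway⟩ := T
  refine ⟨h0, hn.le, hu, ⟨?_, ?_, ?_⟩, ?_, fun _ _ _ _ => rfl⟩
  · intro j hj hjn hjh
    by_cases hjn' : j = n
    · subst hjn'; omega
    · have := hm.range j hj hjn hjn'; omega
  · intro j j' hj hjn hjh hj' hjn' hjh' hpj hjj
    by_cases hj1 : j = n
    · by_cases hj2 : j' = n
      · omega
      · have := hm.range j' hj' hjn' hj2
        subst hj1; omega
    · by_cases hj2 : j' = n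
      · have := hm.range j hj hjn hj1
        subst hj2; omega
      · exact hm.inj j j' hj hjn hj1 hj' hjn' hj2 hpj hjj
  · intro i hi hir
    by_cases hi' : i = r
    · exact ⟨n, by omega, le_rfl, by omega, by omega⟩
    · obtain ⟨j, h1, h2, h3, h4⟩ := hm.surj i hi (by omega)
      refine ⟨j, h1, h2, ?_, h4⟩
      rintro rfl
      omega
  · intro j hj hjn _ hpj
    exact ht j hj hjn hjn.ne hpj

/-- The hole moves towards the root: its predecessor on the path hands over its row. -/
theorem Augmenting.step {n r c h : ℤ} {g : ℤ → ℤ → ℤ} {u v p₀ p used way : ℤ → ℤ}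
    (T : Tree n r c g u v p₀ used way) (A : Augmenting n r h g u v p₀ p used) (hn : h < n) :
    Augmenting n r (way h) g u v p₀ (Function.update p h (p (way h))) used := by
  obtain ⟨h0, -, hu, hm, ht, hunch⟩ := A
  obtain ⟨w0, wn, wu, wlt, wp, wt⟩ := T.way_spec h h0 hn hu
  have hne : way h ≠ h := by intro h; rw [h] at wlt; omega
  have hpw : p (way h) = p₀ (way h) := hunch _ w0 wn wlt.le
  refine ⟨w0, wn, by omega, ⟨?_, ?_, ?_⟩, ?_, ?_⟩
  · intro j hj hjn hjw
    by_cases hjh : j = h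
    · subst hjh; rw [Function.update_self]; exact hm.range _ w0 wn hne
    · rw [Function.update_of_ne hjh]; exact hm.range j hj hjn hjh
  · intro j j' hj hjn hjw hj' hjn' hjw' hpj hjj
    by_cases hjh : j = h <;> by_cases hjh' : j' = h
    · omega
    · subst hjh
      rw [Function.update_self] at hpj hjj
      rw [Function.update_of_ne hjh'] at hjj
      exact absurd (hm.inj _ _ w0 wn hne hj' hjn' hjh' hpj hjj).symm hjw'
    · subst hjh'
      rw [Function.update_of_ne hjh] at hpj hjj
      rw [Function.update_self] at hjj
      exact absurd (hm.inj _ _ hj hjn hjh w0 wn hne hpj hjj) hjw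
    · rw [Function.update_of_ne hjh] at hpj hjj
      rw [Function.update_of_ne hjh'] at hjj
      exact hm.inj _ _ hj hjn hjh hj' hjn' hjh' hpj hjj
  · intro i hi hir
    obtain ⟨j, h1, h2, h3, h4⟩ := hm.surj i hi hir
    by_cases hjw : j = way h
    · exact ⟨h, h0, hn.le, hne.symm, by rw [Function.update_self, ← hjw, h4]⟩
    · exact ⟨j, h1, h2, hjw, by rw [Function.update_of_ne h3, h4]⟩
  · intro j hj hjn hjw hpj
    by_cases hjh : j = h
    · subst hjh
      rw [Function.update_self, hpw]
      exact wt
    · rw [Function.update_of_ne hjh] at hpj ⊢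
      exact ht j hj hjn hjh hpj
  · intro j hj hjn hju
    rw [Function.update_of_ne (by rintro rfl; omega)]
    exact hunch j hj hjn (by omega)

/-! ### The memory layout

Rows are numbered `0, …, n - 1`, and columns `0, …, n - 1` together with the artificial column `n`.
The parts of the program use the following variables and arrays.

* Variables `0`, `1`, `2`: the numbers `d`, `n`, `n + 1`.
* Variable `3`: the index of the current matrix; variable `8`: the address where it starts.
* Variable `4`: the row to be matched; variable `5`: the round of growing the tree or of
  augmenting.
* Variables `6`, `7`, `17`: other loop counters; variables `14`, `16`: auxiliary values.
* Variables `9`, `10`, `11`: the slack, the new column and the old column of an edge that leaves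
  the tree.
* Variable `12`: whether the tree has reached a free column; variable `13`: this column, and later
  the current column of the augmentation.
* Variable `15`: the answer of the oracle.
* Array `0`: the weights; array `1`: the output; arrays `2`, `3`: the multiples of `n`, `n * n`.
* Arrays `4`, `5`: the dual solution `u`, `v`; array `6`: the row matched to each column.
* Arrays `7`, `8`: the arrays `used`, `way` of the tree.
* Array `9`: the vector of weights of the current matching.
* Arrays `10`, `11`: that of the best matching so far, and this matching itself. -/

/-! ### Growing the tree -/

/-- The entry `wᵢⱼ` of the current matrix, with the address computed from the table of row
offsets. -/
def weight (s : Store) (i j : ℤ) : ℤ :=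
  s.arr 0 (s.var 8 + (s.arr 2 i + j))

/-- The expression for the weight of the current matrix. -/
def weightExpr (i j : Expr) : Expr :=
  .read 0 (.add (.var 8) (.add (.read 2 i) j))

/-- The slack of the edge between the row of the column `j` and the column `j'`. -/
def slack (s : Store) (j j' : ℤ) : ℤ :=
  s.arr 4 (s.arr 6 j) + s.arr 5 j' - weight s (s.arr 6 j) j'

/-- The expression for `slack`. -/
def slackExpr (j j' : Expr) : Expr :=
  .sub (.add (.read 4 (.read 6 j)) (.read 5 j')) (weightExpr (.read 6 j) j')

/-- Compare the edge given by the variables `6` and `7` with the best one so far. -/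
def searchStep : Cmd :=
  .cond (.read 7 (.var 7)) .skip
    (.seq (.assign 16 (slackExpr (.var 6) (.var 7)))
      (.cond (.add (.le (.var 10) (.const (-1))) (.le (.add (.var 16) (.const 1)) (.var 9)))
        (.seq (.assign 9 (.var 16)) (.seq (.assign 10 (.var 7)) (.assign 11 (.var 6))))
        .skip))

/-- Find an edge of minimal slack that leaves the tree. -/
def search : Cmd :=
  .seq (.assign 10 (.const (-1)))
    (.forLt 6 2 (.cond (.read 7 (.var 6)) (.forLt 7 1 searchStep) .skip))

variable {d : ℕ} (O : (Fin d → ℤ) → (Fin d → ℤ) → Prop)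

/-- An edge of slack `δ` leaves the tree: it joins the row of the tree column `a` to the column `b`
outside the tree. -/
structure Leaving (s : Store) (a b δ : ℤ) : Prop where
  a_nonneg : 0 ≤ a
  a_le : a ≤ s.var 1
  a_used : s.arr 7 a ≠ 0
  b_nonneg : 0 ≤ b
  b_lt : b < s.var 1
  b_used : s.arr 7 b = 0
  eq_slack : δ = slack s a b

/-- The invariant of the search: the best edge so far is recorded in `s'`, and it is at least as
good as the edges in `D`. -/
def SearchInv (s : Store) (D : ℤ → ℤ → Prop) (s' : Store) : Prop :=
  (s'.var 10 = -1 ∨ Leaving s (s'.var 11) (s'.var 10) (s'.var 9)) ∧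
  ∀ j j', D j j' → Leaving s j j' (slack s j j') → s'.var 10 ≠ -1 ∧ s'.var 9 ≤ slack s j j'

theorem searchInv_searchStep {s s' : Store} {D : ℤ → ℤ → Prop} {a b : ℤ} (ha0 : 0 ≤ a)
    (han : a ≤ s.var 1) (ha : s.arr 7 a ≠ 0) (hb0 : 0 ≤ b) (hbn : b < s.var 1)
    (h6 : s'.var 6 = a) (h7 : s'.var 7 = b) (h8 : s'.var 8 = s.var 8) (harr : s'.arr = s.arr)
    (h : SearchInv s D s') :
    SearchInv s (fun j j' => D j j' ∨ j = a ∧ j' = b) (searchStep.exec O s') := by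
  obtain ⟨h1, h2⟩ := h
  by_cases hb : s.arr 7 b = 0
  · have hnew : Leaving s a b (slack s a b) := ⟨ha0, han, ha, hb0, hbn, hb, rfl⟩
    rw [searchStep, exec_cond_of_eq O (by simp [Expr.eval, h7, harr, hb])]
    have hsl : (slackExpr (.var 6) (.var 7)).eval s' = slack s a b := by
      simp [slackExpr, weightExpr, Expr.eval, slack, weight, h6, h7, h8, harr]
    rw [exec_seq, exec_assign, hsl]
    have htest : (Expr.add (.le (.var 10) (.const (-1)))
        (.le (.add (.var 16) (.const 1)) (.var 9))).eval (s'.setVar 16 (slack s a b)) ≠ 0 ↔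
        s'.var 10 ≤ -1 ∨ slack s a b + 1 ≤ s'.var 9 := by
      rw [eval_le_add_le_ne_zero]
      simp [Expr.eval, Store.var_setVar]
    by_cases hc : s'.var 10 ≤ -1 ∨ slack s a b + 1 ≤ s'.var 9
    · rw [exec_cond_of_ne O (htest.2 hc)]
      simp only [exec_seq, exec_assign, Expr.eval]
      refine ⟨Or.inr ?_, ?_⟩
      · simpa [Store.var_setVar, h6, h7] using hnew
      · simp only [Store.var_setVar, h7, Nat.reduceEqDiff, if_false, if_true]
        rintro j j' (hD | ⟨rfl, rfl⟩) hl
        · have := h2 j j' hD hl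
          refine ⟨by omega, ?_⟩
          rcases h1 with h1 | h1
          · omega
          · have := h1.b_nonneg
            omega
        · exact ⟨by omega, le_rfl⟩
    · rw [exec_cond_of_eq O (not_not.1 (mt htest.1 hc)), exec_skip]
      push Not at hc
      refine ⟨?_, ?_⟩
      · simpa [Store.var_setVar] using h1
      · simp only [Store.var_setVar, Nat.reduceEqDiff, if_false]
        rintro j j' (hD | ⟨rfl, rfl⟩) hl
        · exact h2 j j' hD hl
        · exact ⟨by omega, by omega⟩
  · rw [searchStep, exec_cond_of_ne O (by simp [Expr.eval, h7, harr, hb])]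
    refine ⟨h1, ?_⟩
    rintro j j' (hD | ⟨rfl, rfl⟩) hl
    · exact h2 j j' hD hl
    · exact absurd hl.b_used hb

theorem SearchInv.of_var_eq {s s' s'' : Store} {D D' : ℤ → ℤ → Prop} (h : SearchInv s D s')
    (hv : ∀ x, 9 ≤ x → x ≤ 11 → s''.var x = s'.var x)
    (hD : ∀ j j', D' j j' → Leaving s j j' (slack s j j') → D j j') : SearchInv s D' s'' := by
  unfold SearchInv
  rw [hv 9 (by norm_num) (by norm_num), hv 10 (by norm_num) (by norm_num),
    hv 11 (by norm_num) (by norm_num)]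
  exact ⟨h.1, fun j j' hd hl => h.2 j j' (hD j j' hd hl) hl⟩

/-- The search finds an edge of minimal slack if any edge leaves the tree. -/
theorem exec_search {s : Store} (h2 : s.var 2 = s.var 1 + 1) (h1 : 0 ≤ s.var 1)
    (hex : ∃ a b, Leaving s a b (slack s a b)) :
    Leaving s ((search.exec O s).var 11) ((search.exec O s).var 10) ((search.exec O s).var 9) ∧
    ∀ j j', Leaving s j j' (slack s j j') → (search.exec O s).var 9 ≤ slack s j j' := by
  have key : SearchInv s (fun j _ => j < s.var 2) (search.exec O s) := by
    rw [search, exec]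
    set s₁ := exec O (.assign 10 (.const (-1))) s with hs₁
    have hs₁v : ∀ x, x ≠ 10 → s₁.var x = s.var x := fun x hx => by
      simp [hs₁, exec, Store.var_setVar, hx]
    have hs₁10 : s₁.var 10 = -1 := by
      simp [hs₁, exec, Expr.eval]
    have hs₁a : s₁.arr = s.arr := rfl
    have := exec_forLt O (x := 6) (b := 2) (s := s₁)
      (c := .cond (.read 7 (.var 6)) (.forLt 7 1 searchStep) .skip)
      (fun m s' => SearchInv s (fun j _ => j < m) s') ?_ ?_
    · rw [hs₁v 2 (by decide)] at this
      refine this.of_var_eq (fun _ _ _ => rfl) fun j _ hj _ => ?_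
      omega
    · refine ⟨Or.inl (by simp [Store.var_setVar, hs₁10]), fun j j' hj hl => ?_⟩
      have := hl.a_nonneg
      simp at hj
      omega
    · intro m s' hm h6 hvar harr hinv
      rw [hs₁v 2 (by decide)] at hm
      have harr' : s'.arr = s.arr := funext fun a => harr a List.not_mem_nil
      have hv1 : s'.var 1 = s.var 1 := (hvar 1 (by decide)).trans (hs₁v 1 (by decide))
      have hv8 : s'.var 8 = s.var 8 := (hvar 8 (by decide)).trans (hs₁v 8 (by decide))
      have hset : ∀ (s'' : Store) x, 9 ≤ x → x ≤ 11 →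
          (s''.setVar 6 ((m : ℤ) + 1)).var x = s''.var x := fun s'' x h9 _ => by
        rw [Store.var_setVar, if_neg (by omega)]
      by_cases hu : s.arr 7 m = 0
      · rw [exec_cond_of_eq O (by simp [Expr.eval, h6, harr', hu])]
        refine hinv.of_var_eq (hset s') fun j j' hj hl => ?_
        have := hl.a_used
        have : j ≠ m := by rintro rfl; exact this hu
        push_cast at hj
        omega
      · rw [exec_cond_of_ne O (by simp [Expr.eval, h6, harr', hu])]
        have := exec_forLt O (x := 7) (b := 1) (s := s') (c := searchStep)
          (fun m' s' => SearchInv s (fun j j' => j < m ∨ j = m ∧ j' < m') s') ?_ ?_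
        · refine this.of_var_eq (hset _) fun j j' hj hl => ?_
          have := hl.b_lt
          push_cast at hj
          omega
        · refine hinv.of_var_eq (fun x h9 _ => ?_) fun j j' hj hl => ?_
          · rw [Store.var_setVar, if_neg (by omega)]
          · have := hl.b_nonneg
            push_cast at hj
            omega
        · intro m' s'' hm' h7 hvar' harr'' hinv'
          have := searchInv_searchStep O (s := s) (s' := s'') (a := m) (b := m') (by omega)
            (by omega) hu (by omega) (by omega) ((hvar' 6 (by decide)).trans h6) h7
            ((hvar' 8 (by decide)).trans hv8)
            ((funext fun a => harr'' a List.not_mem_nil).trans harr') hinv'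
          refine this.of_var_eq (fun x h9 _ => ?_) fun j j' hj hl => ?_
          · rw [Store.var_setVar, if_neg (by omega)]
          · push_cast at hj
            omega
  obtain ⟨a, b, hab⟩ := hex
  have hlt : ∀ j j' δ, Leaving s j j' δ → j < s.var 2 := fun j j' δ h => by
    have := h.a_le
    omega
  refine ⟨?_, fun j j' h => (key.2 j j' (hlt _ _ _ h) h).2⟩
  exact key.1.resolve_left (key.2 a b (hlt _ _ _ hab) hab).1

/-- The dual shift at the column in variable `6` and at its row. -/
def dualShiftStep : Cmd :=
  .cond (.read 7 (.var 6))
    (.seq (.store 4 (.read 6 (.var 6)) (.sub (.read 4 (.read 6 (.var 6))) (.var 9)))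
      (.store 5 (.var 6) (.add (.read 5 (.var 6)) (.var 9))))
    .skip

/-- Shift the dual solution by the value of variable `9`: down at the rows of the tree, up at its
columns. -/
def dualShift : Cmd :=
  .forLt 6 2 dualShiftStep

theorem exec_dualShift {s : Store} (h2 : s.var 2 = s.var 1 + 1) (h1 : 0 ≤ s.var 1)
    (hinj : ∀ j j', 0 ≤ j → j ≤ s.var 1 → s.arr 7 j ≠ 0 → 0 ≤ j' → j' ≤ s.var 1 →
      s.arr 7 j' ≠ 0 → s.arr 6 j = s.arr 6 j' → j = j') :
    (∀ j, 0 ≤ j → j ≤ s.var 1 → s.arr 7 j ≠ 0 →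
      (dualShift.exec O s).arr 4 (s.arr 6 j) = s.arr 4 (s.arr 6 j) - s.var 9) ∧
    (∀ i, (∀ j, 0 ≤ j → j ≤ s.var 1 → s.arr 7 j ≠ 0 → s.arr 6 j ≠ i) →
      (dualShift.exec O s).arr 4 i = s.arr 4 i) ∧
    (∀ j, 0 ≤ j → j ≤ s.var 1 → s.arr 7 j ≠ 0 →
      (dualShift.exec O s).arr 5 j = s.arr 5 j + s.var 9) ∧
    (∀ j, s.arr 7 j = 0 → (dualShift.exec O s).arr 5 j = s.arr 5 j) := by
  have := exec_forLt O (x := 6) (b := 2) (s := s) (c := dualShiftStep) (fun m s' =>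
    (∀ j : ℤ, 0 ≤ j → j < m → s.arr 7 j ≠ 0 → s'.arr 4 (s.arr 6 j) = s.arr 4 (s.arr 6 j) - s.var 9) ∧
    (∀ i, (∀ j : ℤ, 0 ≤ j → j < m → s.arr 7 j ≠ 0 → s.arr 6 j ≠ i) → s'.arr 4 i = s.arr 4 i) ∧
    (∀ j : ℤ, 0 ≤ j → j < m → s.arr 7 j ≠ 0 → s'.arr 5 j = s.arr 5 j + s.var 9) ∧
    (∀ j : ℤ, s.arr 7 j = 0 ∨ m ≤ j → s'.arr 5 j = s.arr 5 j)) ?_ ?_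
  · obtain ⟨i1, i2, i3, i4⟩ := this
    refine ⟨fun j h0 hj => i1 j h0 (by omega), fun i hi => i2 i fun j h0 hj => hi j h0 (by omega),
      fun j h0 hj => i3 j h0 (by omega), fun j hj => i4 j (Or.inl hj)⟩
  · refine ⟨fun j h0 hj => ?_, fun _ _ => rfl, fun j h0 hj => ?_, fun _ _ => rfl⟩ <;>
      simp at hj <;> omega
  · rintro m s' hm h6 hvar harr ⟨i1, i2, i3, i4⟩
    have hp : s'.arr 6 = s.arr 6 := harr 6 (by decide)
    have hus : s'.arr 7 = s.arr 7 := harr 7 (by decide)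
    have h9 : s'.var 9 = s.var 9 := hvar 9 (by decide)
    have hsplit : ∀ j : ℤ, j < ((m + 1 : ℕ) : ℤ) → j < m ∨ j = m := fun j hj => by omega
    by_cases hu : s.arr 7 m = 0
    · rw [dualShiftStep, exec_cond_of_eq O (by simp [Expr.eval, h6, hus, hu]), exec_skip,
        Store.setVar_arr]
      refine ⟨fun j h0 hj hju => ?_, fun i hi => i2 i fun j h0 hj => hi j h0 (by omega),
        fun j h0 hj hju => ?_, fun j hj => i4 j (hj.imp_right fun h => by omega)⟩
      · rcases hsplit j hj with hj | rfl
        · exact i1 j h0 hj hju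
        · exact absurd hu hju
      · rcases hsplit j hj with hj | rfl
        · exact i3 j h0 hj hju
        · exact absurd hu hju
    · rw [dualShiftStep, exec_cond_of_ne O (by simp [Expr.eval, h6, hus, hu])]
      -- Distinct tree columns have distinct rows, so this entry has not been shifted before.
      have hpm : s'.arr 4 (s.arr 6 m) = s.arr 4 (s.arr 6 m) := by
        refine i2 _ fun j h0 hj hju hjm => ?_
        have := hinj j m h0 (by omega) hju (by omega) (by omega) hu hjm
        omega
      have hvm : s'.arr 5 m = s.arr 5 m := i4 m (Or.inr le_rfl)
      simp only [exec_seq, exec_store, Expr.eval, Store.setVar_arr, Store.arr_setArr,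
        Store.setArr_var, Nat.reduceEqDiff, if_false, if_true, h6, hp, h9, hpm, hvm]
      refine ⟨fun j h0 hj hju => ?_, fun i hi => ?_, fun j h0 hj hju => ?_, fun j hj => ?_⟩
      · rcases hsplit j hj with hj | rfl
        · rw [Function.update_of_ne, i1 j h0 hj hju]
          intro hjm
          have := hinj j m h0 (by omega) hju (by omega) (by omega) hu hjm
          omega
        · rw [Function.update_self]
      · rw [Function.update_of_ne (hi m (by omega) (by omega) hu).symm]
        exact i2 i fun j h0 hj => hi j h0 (by omega)
      · rcases hsplit j hj with hj | rfl
        · rw [Function.update_of_ne (by omega), i3 j h0 hj hju]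
        · rw [Function.update_self]
      · rw [Function.update_of_ne]
        · exact i4 j (hj.imp_right fun h => by omega)
        · rintro rfl
          rcases hj with hj | hj
          · exact hu hj
          · omega

/-- Add the edge in the variables `10` and `11` to the tree. If its new column is free, record
it in variable `13` and set variable `12`. -/
def extend : Cmd :=
  .seq (.store 7 (.var 10) (.add (.var 5) (.const 2)))
    (.seq (.store 8 (.var 10) (.var 11))
      (.cond (.le (.const 0) (.read 6 (.var 10))) .skip
        (.seq (.assign 12 (.const 1)) (.assign 13 (.var 10)))))

theorem exec_extend (s : Store) :
    (extend.exec O s).arr 7 = Function.update (s.arr 7) (s.var 10) (s.var 5 + 2) ∧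
    (extend.exec O s).arr 8 = Function.update (s.arr 8) (s.var 10) (s.var 11) ∧
    (0 ≤ s.arr 6 (s.var 10) ∧ (extend.exec O s).var 12 = s.var 12 ∨
      s.arr 6 (s.var 10) < 0 ∧ (extend.exec O s).var 12 = 1 ∧
        (extend.exec O s).var 13 = s.var 10) := by
  rw [extend, exec_seq, exec_seq, exec_store, exec_store]
  by_cases h : 0 ≤ s.arr 6 (s.var 10)
  · rw [exec_cond_of_ne O (by simp [Expr.eval, Store.arr_setArr, h]), exec_skip]
    simp [Store.arr_setArr, Expr.eval, h]
  · rw [exec_cond_of_eq O (by simpa [Expr.eval, Store.arr_setArr] using h)]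
    simp [Store.arr_setArr, Expr.eval, exec_seq, exec_assign, Store.var_setVar, not_le.1 h]

/-- Shift the dual solution until an edge that leaves the tree becomes tight, and add it. -/
def grow : Cmd :=
  .seq search (.seq dualShift extend)

theorem weight_congr {s s' : Store} (h0 : s'.arr 0 = s.arr 0) (h2 : s'.arr 2 = s.arr 2)
    (h8 : s'.var 8 = s.var 8) : weight s' = weight s := by
  funext i j
  simp [weight, h0, h2, h8]

/-- The alternating tree in memory after `c` extensions. -/
def TreeAt (s : Store) (r c : ℤ) : Prop :=
  Tree (s.var 1) r c (weight s) (s.arr 4) (s.arr 5) (s.arr 6) (s.arr 7) (s.arr 8)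

theorem exec_grow {s : Store} {r : ℤ} (c : ℕ) (h2 : s.var 2 = s.var 1 + 1) (h5 : s.var 5 = c)
    (T : TreeAt s r c) (hC : Closed (s.var 1) (s.arr 6) (s.arr 7))
    (hcard : (treeColumns (s.var 1) (s.arr 7)).card = c) :
    TreeAt (grow.exec O s) r (c + 1) ∧
    ((grow.exec O s).var 12 = s.var 12 ∧
        Closed (s.var 1) (s.arr 6) ((grow.exec O s).arr 7) ∧
        (treeColumns (s.var 1) ((grow.exec O s).arr 7)).card = c + 1 ∨
      (grow.exec O s).var 12 = 1 ∧ 0 ≤ (grow.exec O s).var 13 ∧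
        (grow.exec O s).var 13 < s.var 1 ∧
        (grow.exec O s).arr 7 ((grow.exec O s).var 13) ≠ 0 ∧
        s.arr 6 ((grow.exec O s).var 13) = -1) := by
  have h1 : 0 ≤ s.var 1 := T.root_nonneg.trans T.root_lt.le
  have hCn : ∀ j, 0 ≤ j → j ≤ s.var 1 → s.arr 7 j ≠ 0 → 0 ≤ s.arr 6 j := by
    intro j hj hjn hju
    by_cases hj' : j = s.var 1
    · rw [hj', T.apply_root]; exact T.root_nonneg
    · exact hC j hj (by omega) hju
  have hex : ∃ a b, Leaving s a b (slack s a b) := by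
    obtain ⟨b, hb0, hbn, hb⟩ := T.matching.exists_free T.root_nonneg T.root_lt
    refine ⟨s.var 1, b, h1, le_rfl, by rw [T.used_root]; exact one_ne_zero, hb0, hbn, ?_, rfl⟩
    by_contra hbu
    have := hC b hb0 hbn hbu
    omega
  have hinj : ∀ j j', 0 ≤ j → j ≤ s.var 1 → s.arr 7 j ≠ 0 → 0 ≤ j' → j' ≤ s.var 1 →
      s.arr 7 j' ≠ 0 → s.arr 6 j = s.arr 6 j' → j = j' := by
    intro j j' h0 hn hu h0' hn' hu' hjj
    have hr := T.apply_root
    by_cases hj : j = s.var 1 <;> by_cases hj' : j' = s.var 1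
    · omega
    · have := T.matching.range j' h0' hn' hj'
      rw [hj] at hjj
      omega
    · have := T.matching.range j h0 hn hj
      rw [hj'] at hjj
      omega
    · exact T.matching.inj j j' h0 hn hj h0' hn' hj' (hCn j h0 hn hu) hjj
  obtain ⟨hl, hmin⟩ := exec_search O h2 h1 hex
  rw [grow, exec_seq, exec_seq]
  set s₁ := search.exec O s with hs₁
  have v₁ : ∀ x, x ∉ search.wvars → s₁.var x = s.var x := fun x hx =>
    Cmd.exec_var_of_notMem O hx s
  have a₁ : s₁.arr = s.arr := funext fun a => Cmd.exec_arr_of_notMem O List.not_mem_nil s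
  have hd := exec_dualShift O (s := s₁)
    (by rw [v₁ 1 (by decide), v₁ 2 (by decide), h2]) (by rw [v₁ 1 (by decide)]; exact h1)
    (by rw [v₁ 1 (by decide), a₁]; exact hinj)
  set s₂ := dualShift.exec O s₁ with hs₂
  have v₂ : ∀ x, x ∉ dualShift.wvars → s₂.var x = s₁.var x := fun x hx =>
    Cmd.exec_var_of_notMem O hx s₁
  have a₂ : ∀ a, a ∉ dualShift.warrs → s₂.arr a = s.arr a := fun a ha =>
    (Cmd.exec_arr_of_notMem O ha s₁).trans (by rw [a₁])
  obtain ⟨he7, he8, he⟩ := exec_extend O s₂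
  set s₃ := extend.exec O s₂ with hs₃
  have v₃ : ∀ x, x ∉ extend.wvars → s₃.var x = s₂.var x := fun x hx =>
    Cmd.exec_var_of_notMem O hx s₂
  have a₃ : ∀ a, a ∉ extend.warrs → s₃.arr a = s₂.arr a := fun a ha =>
    Cmd.exec_arr_of_notMem O ha s₂
  rw [a₁, v₁ 1 (by decide)] at hd
  obtain ⟨hu, hu', hv, hv'⟩ := hd
  have hδ : 0 ≤ s₁.var 9 := by
    rw [hl.eq_slack, slack]
    have hr := T.matching.range
    have := T.feasible (s.arr 6 (s₁.var 11)) (s₁.var 10) (hCn _ hl.a_nonneg hl.a_le hl.a_used)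
      (by
        by_cases h : s₁.var 11 = s.var 1
        · rw [h, T.apply_root]; exact T.root_lt
        · exact (hr _ hl.a_nonneg hl.a_le h).2.trans T.root_lt) hl.b_nonneg hl.b_lt
    omega
  have T₂ : Tree (s.var 1) r c (weight s) (s₂.arr 4) (s₂.arr 5) (s.arr 6) (s.arr 7) (s.arr 8) :=
    Tree.dual_shift T hC hδ
      (fun j h0 hn hju j' h0' hn' hju' => hmin j j' ⟨h0, hn, hju, h0', hn', hju', rfl⟩)
      hu hu' hv fun j _ _ hj => hv' j hj
  have htight : s₂.arr 4 (s.arr 6 (s₁.var 11)) + s₂.arr 5 (s₁.var 10)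
      = weight s (s.arr 6 (s₁.var 11)) (s₁.var 10) := by
    rw [hu _ hl.a_nonneg hl.a_le hl.a_used, hv' _ hl.b_used]
    have := hl.eq_slack
    rw [slack] at this
    omega
  have T₃ := T₂.extend (by omega) hl.a_nonneg hl.a_le hl.a_used
    (hCn _ hl.a_nonneg hl.a_le hl.a_used) hl.b_nonneg hl.b_lt hl.b_used htight
  have e10 : s₂.var 10 = s₁.var 10 := v₂ 10 (by decide)
  have e11 : s₂.var 11 = s₁.var 11 := v₂ 11 (by decide)
  have e5 : s₂.var 5 = c := ((v₂ 5 (by decide)).trans (v₁ 5 (by decide))).trans h5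
  have e12 : s₂.var 12 = s.var 12 := (v₂ 12 (by decide)).trans (v₁ 12 (by decide))
  have e1 : s₃.var 1 = s.var 1 :=
    ((v₃ 1 (by decide)).trans (v₂ 1 (by decide))).trans (v₁ 1 (by decide))
  have e8 : s₃.var 8 = s.var 8 :=
    ((v₃ 8 (by decide)).trans (v₂ 8 (by decide))).trans (v₁ 8 (by decide))
  have ew : weight s₃ = weight s := weight_congr ((a₃ 0 (by decide)).trans (a₂ 0 (by decide)))
    ((a₃ 2 (by decide)).trans (a₂ 2 (by decide))) e8
  rw [a₂ 7 (by decide), e10, e5] at he7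
  rw [a₂ 8 (by decide), e10, e11] at he8
  rw [a₂ 6 (by decide), e10, e12] at he
  refine ⟨?_, ?_⟩
  · rw [TreeAt, e1, ew, a₃ 4 (by decide), a₃ 5 (by decide), a₃ 6 (by decide), a₂ 6 (by decide),
      he7, he8]
    exact T₃
  · rcases he with ⟨hp, h12⟩ | ⟨hp, h12, h13⟩
    · refine Or.inl ⟨h12, ?_, ?_⟩
      · intro j h0 hn hju
        by_cases hj : j = s₁.var 10
        · rw [hj]; exact hp
        · rw [he7, Function.update_of_ne hj] at hju
          exact hC j h0 hn hju
      · rw [he7, card_treeColumns_update hl.b_nonneg hl.b_lt hl.b_used (by omega), hcard]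
    · refine Or.inr ⟨h12, ?_, ?_, ?_, ?_⟩
      · rw [h13]; exact hl.b_nonneg
      · rw [h13]; exact hl.b_lt
      · rw [h13, he7, Function.update_self]; omega
      · rw [h13]
        have := T.matching.range _ hl.b_nonneg hl.b_lt.le hl.b_lt.ne
        omega

/-- Grow the tree until it reaches a free column. -/
def growTree : Cmd :=
  .seq (.assign 12 (.const 0)) (.forLt 5 1 (.cond (.var 12) .skip grow))

theorem Tree.succ {n r c : ℤ} {g : ℤ → ℤ → ℤ} {u v p used way : ℤ → ℤ}
    (T : Tree n r c g u v p used way) : Tree n r (c + 1) g u v p used way :=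
  { T with used_range := fun j h0 hn => by have := T.used_range j h0 hn; omega }

theorem TreeAt.congr {s s' : Store} {r c : ℤ} (h : TreeAt s r c) (h1 : s'.var 1 = s.var 1)
    (h8 : s'.var 8 = s.var 8) (ha : s'.arr = s.arr) : TreeAt s' r c := by
  rw [TreeAt, h1, weight_congr (by rw [ha]) (by rw [ha]) h8, ha]
  exact h

theorem exec_growTree {s : Store} {r : ℤ} (h2 : s.var 2 = s.var 1 + 1)
    (T : TreeAt s r 0) (hC : ∀ j, 0 ≤ j → j < s.var 1 → s.arr 7 j = 0) :
    TreeAt (growTree.exec O s) r (s.var 1) ∧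
    0 ≤ (growTree.exec O s).var 13 ∧ (growTree.exec O s).var 13 < s.var 1 ∧
    (growTree.exec O s).arr 7 ((growTree.exec O s).var 13) ≠ 0 ∧
    s.arr 6 ((growTree.exec O s).var 13) = -1 := by
  have h1 : 0 ≤ s.var 1 := T.root_nonneg.trans T.root_lt.le
  rw [growTree, exec_seq, exec_assign]
  set s₁ := s.setVar 12 ((Expr.const 0).eval s) with hs₁
  have v₁ : ∀ x, x ≠ 12 → s₁.var x = s.var x := fun x hx => Store.setVar_var_of_ne hx _ _
  have h12 : s₁.var 12 = 0 := by simp [hs₁, Expr.eval]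
  have a₁ : s₁.arr = s.arr := rfl
  have key := exec_forLt O (x := 5) (b := 1) (s := s₁) (c := .cond (.var 12) .skip grow)
    (fun m s' => s'.var 1 = s.var 1 ∧ TreeAt s' r m ∧
      (s'.var 12 = 0 ∧ Closed (s.var 1) (s.arr 6) (s'.arr 7) ∧
          (treeColumns (s.var 1) (s'.arr 7)).card = m ∨
        s'.var 12 = 1 ∧ 0 ≤ s'.var 13 ∧ s'.var 13 < s.var 1 ∧ s'.arr 7 (s'.var 13) ≠ 0 ∧
          s.arr 6 (s'.var 13) = -1)) ?_ ?_
  · rw [v₁ 1 (by decide)] at key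
    set s₂ := exec O (.forLt 5 1 (.cond (.var 12) .skip grow)) s₁ with hs₂
    obtain ⟨e1, hT, hcase⟩ := key
    rw [Int.toNat_of_nonneg h1] at hT
    refine ⟨hT, ?_⟩
    rcases hcase with ⟨-, hcl, hcard⟩ | ⟨-, h⟩
    · have hT' := hT
      rw [TreeAt, e1] at hT'
      have hp : s₂.arr 6 = s.arr 6 := (Cmd.exec_arr_of_notMem O (by decide) s₁).trans (by rw [a₁])
      have := lt_of_closed hT' (by rw [hp]; exact hcl)
      omega
    · exact h
  · refine ⟨?_, ?_, Or.inl ⟨?_, ?_, ?_⟩⟩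
    · rw [Store.setVar_var_of_ne (by decide), v₁ 1 (by decide)]
    · refine T.congr ?_ ?_ rfl
      · rw [Store.setVar_var_of_ne (by decide), v₁ 1 (by decide)]
      · rw [Store.setVar_var_of_ne (by decide), v₁ 8 (by decide)]
    · rw [Store.setVar_var_of_ne (by decide), h12]
    · intro j h0 hn hju
      exact absurd (hC j h0 hn) hju
    · rw [Finset.card_eq_zero, treeColumns, Finset.filter_eq_empty_iff]
      intro j hj
      rw [Finset.mem_Ico] at hj
      exact not_not.2 (hC j hj.1 hj.2)
  · rintro m s' hm h5 hvar harr ⟨e1, hT, hcase⟩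
    have e2 : s'.var 2 = s.var 2 := (hvar 2 (by decide)).trans (v₁ 2 (by decide))
    have hp : s'.arr 6 = s.arr 6 := (harr 6 (by decide)).trans (by rw [a₁])
    rcases hcase with ⟨hf, hcl, hcard⟩ | ⟨hf, h⟩
    · rw [exec_cond_of_eq O (by simpa [Expr.eval] using hf)]
      have := exec_grow O (s := s') m (by rw [e1, e2, h2]) h5 hT (by rw [e1, hp]; exact hcl)
        (by rw [e1]; exact hcard)
      have g1 : (grow.exec O s').var 1 = s'.var 1 := Cmd.exec_var_of_notMem O (by decide) _
      rw [hf, e1, hp] at this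
      refine ⟨?_, ?_, ?_⟩
      · rw [Store.setVar_var_of_ne (by decide), g1, e1]
      · refine TreeAt.congr (s := grow.exec O s') ?_ (Store.setVar_var_of_ne (by decide) _ _)
          (Store.setVar_var_of_ne (by decide) _ _) rfl
        push_cast
        exact this.1
      · rw [Store.setVar_var_of_ne (by decide), Store.setVar_var_of_ne (by decide)]
        exact this.2
    · rw [exec_cond_of_ne O (by simp [Expr.eval, hf]), exec_skip]
      refine ⟨?_, ?_, Or.inr ?_⟩
      · rw [Store.setVar_var_of_ne (by decide), e1]
      · refine TreeAt.congr (s := s') ?_ (Store.setVar_var_of_ne (by decide) _ _)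
          (Store.setVar_var_of_ne (by decide) _ _) rfl
        push_cast
        exact Tree.succ hT
      · rw [Store.setVar_var_of_ne (by decide), Store.setVar_var_of_ne (by decide)]
        exact ⟨hf, h⟩

/-! ### Solving one assignment problem -/

/-- Give the current column the row of its predecessor, which becomes the current column. -/
def augmentStep : Cmd :=
  .cond (.le (.var 1) (.var 13)) .skip
    (.seq (.store 6 (.var 13) (.read 6 (.read 8 (.var 13)))) (.assign 13 (.read 8 (.var 13))))

/-- Exchange the matching along the tree path from the free column in variable `13` to the
artificial column. -/
def augment : Cmd :=
  .forLt 5 1 augmentStep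

theorem exec_augment {s : Store} {r : ℤ} (T : TreeAt s r (s.var 1)) (h0 : 0 ≤ s.var 13)
    (hn : s.var 13 < s.var 1) (hu : s.arr 7 (s.var 13) ≠ 0) (hp : s.arr 6 (s.var 13) = -1) :
    Matching (s.var 1) (r + 1) (s.var 1) ((augment.exec O s).arr 6) ∧
    Tight (s.var 1) (s.var 1) (weight s) (s.arr 4) (s.arr 5) ((augment.exec O s).arr 6) := by
  have h1 : 0 ≤ s.var 1 := T.root_nonneg.trans T.root_lt.le
  -- The time stamp of the current column decreases in every step.
  have key := exec_forLt O (x := 5) (b := 1) (s := s) (c := augmentStep)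
    (fun m s' => Augmenting (s.var 1) r (s'.var 13) (weight s) (s.arr 4) (s.arr 5) (s.arr 6)
        (s'.arr 6) (s.arr 7) ∧
      (s'.var 13 = s.var 1 ∨ s.arr 7 (s'.var 13) ≤ s.var 1 + 1 - m)) ?_ ?_
  · change Augmenting _ _ ((augment.exec O s).var 13) _ _ _ _ ((augment.exec O s).arr 6) _ ∧
      ((augment.exec O s).var 13 = s.var 1 ∨ s.arr 7 ((augment.exec O s).var 13) ≤ _) at key
    obtain ⟨A, hA⟩ := key
    have hend : (augment.exec O s).var 13 = s.var 1 := by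
      by_contra hne
      have hle := A.le
      obtain ⟨-, -, w3, w4, -⟩ := T.way_spec _ A.nonneg (by omega) A.used_ne
      have := hA.resolve_left hne
      omega
    have hm := A.matching
    have ht := A.tight
    rw [hend] at hm ht
    exact ⟨hm, ht⟩
  · rw [Store.setVar_var_of_ne (by decide), Store.setVar_arr]
    refine ⟨Tree.augmenting T h0 hn hu hp, Or.inr ?_⟩
    have := T.used_range _ h0 hn.le
    push_cast
    omega
  · rintro m s' hm h5 hvar harr ⟨A, hA⟩
    have e1 : s'.var 1 = s.var 1 := hvar 1 (by decide)
    have e8 : s'.arr 8 = s.arr 8 := harr 8 (by decide)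
    have hle := A.le
    by_cases hend : s'.var 13 = s.var 1
    · rw [augmentStep, exec_cond_of_ne O (by simp [Expr.eval, e1, hend]), exec_skip,
        Store.setVar_var_of_ne (by decide), Store.setVar_arr]
      exact ⟨A, Or.inl hend⟩
    · have hlt : s'.var 13 < s.var 1 := by omega
      rw [augmentStep, exec_cond_of_eq O (by simpa [Expr.eval, e1] using hlt)]
      have A' := A.step T hlt
      obtain ⟨-, -, w3, w4, -⟩ := T.way_spec _ A.nonneg hlt A.used_ne
      have := hA.resolve_left hend
      simp only [exec_seq, exec_store, exec_assign, Expr.eval, Store.setVar_arr, Store.arr_setArr,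
        Store.setArr_var, Store.var_setVar, Nat.reduceEqDiff, if_false, if_true, e8]
      refine ⟨A', Or.inr ?_⟩
      push_cast
      omega

/-- Start a tree at the row in variable `4`. -/
def initTree : Cmd :=
  .seq (.store 6 (.var 1) (.var 4))
    (.seq (.forLt 6 1 (.store 7 (.var 6) (.const 0))) (.store 7 (.var 1) (.const 1)))

theorem exec_initTree {s : Store} (h1 : 0 ≤ s.var 1) :
    (initTree.exec O s).arr 6 = Function.update (s.arr 6) (s.var 1) (s.var 4) ∧
    (initTree.exec O s).arr 7 (s.var 1) = 1 ∧
    ∀ j, 0 ≤ j → j < s.var 1 → (initTree.exec O s).arr 7 j = 0 := by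
  rw [initTree, exec_seq, exec_seq]
  set s₁ := exec O (.store 6 (.var 1) (.var 4)) s with hs₁
  have v₁ : s₁.var = s.var := rfl
  have a₁ : s₁.arr 6 = Function.update (s.arr 6) (s.var 1) (s.var 4) := by
    simp [hs₁, exec_store, Expr.eval]
  have key := exec_forLt O (x := 6) (b := 1) (s := s₁) (c := .store 7 (.var 6) (.const 0))
    (fun m s' => ∀ j : ℤ, 0 ≤ j → j < m → s'.arr 7 j = 0) ?_ ?_
  · set s₂ := exec O (.forLt 6 1 (.store 7 (.var 6) (.const 0))) s₁ with hs₂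
    have a₂ : s₂.arr 6 = s₁.arr 6 := Cmd.exec_arr_of_notMem O (by decide) _
    have v₂ : s₂.var 1 = s.var 1 := Cmd.exec_var_of_notMem O (by decide) _
    rw [exec_store]
    simp only [Store.arr_setArr, Expr.eval, Nat.reduceEqDiff, if_false, if_true, a₂, a₁, v₂]
    refine ⟨trivial, Function.update_self .., fun j h0 hj => ?_⟩
    rw [Function.update_of_ne (by omega)]
    rw [v₁] at key
    exact key j h0 (by omega)
  · intro j h0 hj
    push_cast at hj
    omega
  · intro m s' hm h6 hvar harr ih j h0 hj
    rw [exec_store]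
    simp only [Store.setVar_arr, Store.setArr_arr_self, Expr.eval, h6]
    by_cases hjm : j = m
    · rw [hjm, Function.update_self]
    · rw [Function.update_of_ne hjm]
      push_cast at hj
      exact ih j h0 (by omega)

/-- The rows `0, …, r - 1` are matched by tight edges of a feasible dual solution. -/
structure Solved (s : Store) (r : ℤ) : Prop where
  matching : Matching (s.var 1) r (s.var 1) (s.arr 6)
  feasible : Feasible (s.var 1) (weight s) (s.arr 4) (s.arr 5)
  tight : Tight (s.var 1) (s.var 1) (weight s) (s.arr 4) (s.arr 5) (s.arr 6)

theorem Solved.congr {s s' : Store} {r : ℤ} (h : Solved s r) (h1 : s'.var 1 = s.var 1)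
    (h8 : s'.var 8 = s.var 8) (ha : s'.arr = s.arr) : Solved s' r := by
  have hw := weight_congr (s := s) (s' := s') (by rw [ha]) (by rw [ha]) h8
  obtain ⟨a, b, c⟩ := h
  constructor <;> simpa only [h1, ha, hw]

/-- Match the row in variable `4`. -/
def phase : Cmd :=
  .seq initTree (.seq growTree augment)

/-- Matching one more row: the tree finds a free column, and the augmentation uses it. -/
theorem exec_phase {s : Store} {r : ℤ} (h2 : s.var 2 = s.var 1 + 1) (h4 : s.var 4 = r)
    (hr0 : 0 ≤ r) (hrn : r < s.var 1) (hs : Solved s r) : Solved (phase.exec O s) (r + 1) := by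
  have h1 : 0 ≤ s.var 1 := by omega
  rw [phase, exec_seq, exec_seq]
  obtain ⟨i6, i7, i7'⟩ := exec_initTree O (s := s) h1
  set s₁ := initTree.exec O s with hs₁
  have v₁ : ∀ x, x ∉ initTree.wvars → s₁.var x = s.var x := fun x hx =>
    Cmd.exec_var_of_notMem O hx _
  have a₁ : ∀ a, a ∉ initTree.warrs → s₁.arr a = s.arr a := fun x hx =>
    Cmd.exec_arr_of_notMem O hx _
  have e1 : s₁.var 1 = s.var 1 := v₁ 1 (by decide)
  have ew : weight s₁ = weight s :=
    weight_congr (a₁ 0 (by decide)) (a₁ 2 (by decide)) (v₁ 8 (by decide))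
  obtain ⟨hm, hf, ht⟩ := hs
  have T₁ : TreeAt s₁ r 0 := by
    rw [TreeAt, e1, ew, a₁ 4 (by decide), a₁ 5 (by decide), i6, h4]
    have hne : ∀ j, j ≠ s.var 1 → Function.update (s.arr 6) (s.var 1) r j = s.arr 6 j :=
      fun j hj => Function.update_of_ne hj _ _
    refine ⟨hr0, hrn, Function.update_self .., ⟨?_, ?_, ?_⟩, hf, ?_, ?_, i7, ?_⟩
    · intro j h0 hn hj
      rw [hne j hj]
      exact hm.range j h0 hn hj
    · intro j j' h0 hn hj h0' hn' hj'
      rw [hne j hj, hne j' hj']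
      exact hm.inj j j' h0 hn hj h0' hn' hj'
    · intro i hi hir
      obtain ⟨j, b1, b2, b3, b4⟩ := hm.surj i hi hir
      exact ⟨j, b1, b2, b3, by rw [hne j b3, b4]⟩
    · intro j h0 hn hj
      rw [hne j hj]
      exact ht j h0 hn hj
    · intro j h0 hn
      by_cases hj : j = s.var 1
      · rw [hj, i7]; norm_num
      · rw [i7' j h0 (by omega)]; norm_num
    · intro j h0 hn hj
      exact absurd (i7' j h0 hn) hj
  obtain ⟨T₂, b1, b2, b3, b4⟩ := exec_growTree O (s := s₁) (by rw [e1, v₁ 2 (by decide), h2]) T₁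
    (by rw [e1]; exact i7')
  set s₂ := growTree.exec O s₁ with hs₂
  have v₂ : ∀ x, x ∉ growTree.wvars → s₂.var x = s₁.var x := fun x hx =>
    Cmd.exec_var_of_notMem O hx _
  have a₂ : ∀ a, a ∉ growTree.warrs → s₂.arr a = s₁.arr a := fun x hx =>
    Cmd.exec_arr_of_notMem O hx _
  have e2 : s₂.var 1 = s₁.var 1 := v₂ 1 (by decide)
  rw [← e2] at T₂ b2
  obtain ⟨c1, c2⟩ := exec_augment O T₂ b1 b2 b3 (by rw [a₂ 6 (by decide)]; exact b4)
  set s₃ := augment.exec O s₂ with hs₃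
  have v₃ : ∀ x, x ∉ augment.wvars → s₃.var x = s₂.var x := fun x hx =>
    Cmd.exec_var_of_notMem O hx _
  have a₃ : ∀ a, a ∉ augment.warrs → s₃.arr a = s₂.arr a := fun x hx =>
    Cmd.exec_arr_of_notMem O hx _
  have ew₃ : weight s₃ = weight s₂ :=
    weight_congr (a₃ 0 (by decide)) (a₃ 2 (by decide)) (v₃ 8 (by decide))
  refine ⟨?_, ?_, ?_⟩
  · rw [v₃ 1 (by decide)]; exact c1
  · rw [v₃ 1 (by decide), ew₃, a₃ 4 (by decide), a₃ 5 (by decide)]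
    exact Tree.feasible T₂
  · rw [v₃ 1 (by decide), ew₃, a₃ 4 (by decide), a₃ 5 (by decide)]
    exact c2

/-- Match all rows, one after the other. -/
def matchAll : Cmd :=
  .forLt 4 1 phase

theorem exec_matchAll {s : Store} (h1 : 0 ≤ s.var 1) (h2 : s.var 2 = s.var 1 + 1)
    (hs : Solved s 0) : Solved (matchAll.exec O s) (s.var 1) := by
  have key := exec_forLt O (x := 4) (b := 1) (s := s) (c := phase) (fun m s' => Solved s' m) ?_ ?_
  · rw [Int.toNat_of_nonneg h1] at key
    exact key
  · exact hs.congr (Store.setVar_var_of_ne (by decide) _ _)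
      (Store.setVar_var_of_ne (by decide) _ _) rfl
  · intro m s' hm h4 hvar harr ih
    have e1 : s'.var 1 = s.var 1 := hvar 1 (by decide)
    have e2 : s'.var 2 = s.var 2 := hvar 2 (by decide)
    have := exec_phase O (s := s') (by rw [e1, e2, h2]) h4 (by omega) (by omega) ih
    refine Solved.congr (s := phase.exec O s') ?_ (Store.setVar_var_of_ne (by decide) _ _)
      (Store.setVar_var_of_ne (by decide) _ _) rfl
    push_cast
    exact this

/-- The initial state of the row and the column with the number in variable `17`. -/
def initRow : Cmd :=
  .seq (.store 4 (.var 17) (.const 0)) (.seq (.store 5 (.var 17) (.const 0))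
    (.seq (.store 6 (.var 17) (.const (-1)))
      (.forLt 6 1 (.store 4 (.var 17)
        (.add (.read 4 (.var 17)) (weightExpr (.var 17) (.var 6)))))))

/-- Start with the empty matching and the dual solution that consists of the row sums. -/
def initDual : Cmd :=
  .forLt 17 1 initRow

theorem exec_initRow {s : Store} {i : ℤ} (h17 : s.var 17 = i) :
    (initRow.exec O s).arr 4 = Function.update (s.arr 4) i
      (∑ j ∈ Finset.range (s.var 1).toNat, weight s i j) ∧
    (initRow.exec O s).arr 5 = Function.update (s.arr 5) i 0 ∧
    (initRow.exec O s).arr 6 = Function.update (s.arr 6) i (-1) := by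
  rw [initRow, exec_seq, exec_seq, exec_seq, exec_store, exec_store, exec_store]
  simp only [Expr.eval, Store.setArr_var, h17]
  set s₁ := ((s.setArr 4 i 0).setArr 5 i 0).setArr 6 i (-1) with hs₁
  have v₁ : s₁.var = s.var := rfl
  have a4 : s₁.arr 4 = Function.update (s.arr 4) i 0 := by simp [hs₁, Store.arr_setArr]
  have a5 : s₁.arr 5 = Function.update (s.arr 5) i 0 := by simp [hs₁, Store.arr_setArr]
  have a6 : s₁.arr 6 = Function.update (s.arr 6) i (-1) := by simp [hs₁, Store.arr_setArr]
  have a0 : s₁.arr 0 = s.arr 0 := by simp [hs₁, Store.arr_setArr]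
  have a2 : s₁.arr 2 = s.arr 2 := by simp [hs₁, Store.arr_setArr]
  refine ⟨?_, (Cmd.exec_arr_of_notMem O (by decide) _).trans a5,
    (Cmd.exec_arr_of_notMem O (by decide) _).trans a6⟩
  refine exec_forLt O (x := 6) (b := 1) (s := s₁) (fun m s' => s'.arr 4 =
    Function.update (s.arr 4) i (∑ j ∈ Finset.range m, weight s i j)) ?_ ?_
  · simpa using a4
  · intro m s' hm h6 hvar harr ih
    have e17 : s'.var 17 = i := (hvar 17 (by decide)).trans h17
    have e8 : s'.var 8 = s.var 8 := hvar 8 (by decide)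
    have e0 : s'.arr 0 = s.arr 0 := (harr 0 (by decide)).trans a0
    have e2 : s'.arr 2 = s.arr 2 := (harr 2 (by decide)).trans a2
    rw [exec_store]
    simp only [Store.setVar_arr, Store.setArr_arr_self, Expr.eval, weightExpr, e17, e8, e0, e2, h6,
      ih, Function.update_self, Function.update_idem, Finset.sum_range_succ, weight]

theorem exec_initDual {s : Store} (h1 : 0 ≤ s.var 1)
    (hw : ∀ i j, 0 ≤ i → i < s.var 1 → 0 ≤ j → j < s.var 1 → 0 ≤ weight s i j) :
    Solved (initDual.exec O s) 0 := by
  have key := exec_forLt O (x := 17) (b := 1) (s := s) (c := initRow) (fun m s' =>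
    ∀ i : ℤ, 0 ≤ i → i < m →
      s'.arr 4 i = (∑ j ∈ Finset.range (s.var 1).toNat, weight s i j) ∧
      s'.arr 5 i = 0 ∧ s'.arr 6 i = -1) ?_ ?_
  · rw [Int.toNat_of_nonneg h1] at key
    change ∀ i : ℤ, 0 ≤ i → i < s.var 1 → (initDual.exec O s).arr 4 i = _ ∧
      (initDual.exec O s).arr 5 i = 0 ∧ (initDual.exec O s).arr 6 i = -1 at key
    set s₁ := initDual.exec O s with hs₁
    have e1 : s₁.var 1 = s.var 1 := Cmd.exec_var_of_notMem O (by decide) _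
    have ew : weight s₁ = weight s := weight_congr (Cmd.exec_arr_of_notMem O (by decide) _)
      (Cmd.exec_arr_of_notMem O (by decide) _) (Cmd.exec_var_of_notMem O (by decide) _)
    refine ⟨⟨?_, ?_, ?_⟩, ?_, ?_⟩ <;> rw [e1]
    · intro j h0 hn hj
      rw [(key j h0 (by omega)).2.2]
      omega
    · intro j j' h0 hn hj h0' hn' hj' hp
      rw [(key j h0 (by omega)).2.2] at hp
      omega
    · intro i h0 hi
      omega
    · intro i j h0 hn h0' hn'
      rw [ew, (key i h0 hn).1, (key j h0' hn').2.1, add_zero]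
      have hmem : j.toNat ∈ Finset.range (s.var 1).toNat := by
        rw [Finset.mem_range]; omega
      have := Finset.single_le_sum (f := fun j : ℕ => weight s i j) (fun j' hj' => by
        rw [Finset.mem_range] at hj'
        exact hw i j' h0 hn (by omega) (by omega)) hmem
      simpa only [Int.toNat_of_nonneg h0'] using this
    · intro j h0 hn hj hp
      rw [(key j h0 (by omega)).2.2] at hp
      omega
  · intro i h0 hi
    push_cast at hi
    omega
  · intro m s' hm h17 hvar harr ih i h0 hi
    obtain ⟨r4, r5, r6⟩ := exec_initRow O h17
    have e1 : s'.var 1 = s.var 1 := hvar 1 (by decide)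
    have ew : weight s' = weight s := weight_congr (harr 0 (by decide)) (harr 2 (by decide))
      (hvar 8 (by decide))
    rw [Store.setVar_arr, r4, r5, r6, e1, ew]
    by_cases him : i = m
    · subst him; simp
    · simp only [Function.update_of_ne him]
      push_cast at hi
      exact ih i h0 (by omega)

/-- Solve the assignment problem for the weights of the current matrix. -/
def solve : Cmd :=
  .seq initDual matchAll

theorem exec_solve {s : Store} (h1 : 0 ≤ s.var 1) (h2 : s.var 2 = s.var 1 + 1)
    (hw : ∀ i j, 0 ≤ i → i < s.var 1 → 0 ≤ j → j < s.var 1 → 0 ≤ weight s i j) :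
    Solved (solve.exec O s) (s.var 1) := by
  rw [solve, exec_seq]
  have e1 : (initDual.exec O s).var 1 = s.var 1 := Cmd.exec_var_of_notMem O (by decide) _
  have e2 : (initDual.exec O s).var 2 = s.var 2 := Cmd.exec_var_of_notMem O (by decide) _
  have := exec_matchAll O (s := initDual.exec O s) (by rw [e1]; exact h1) (by rw [e1, e2, h2])
    (exec_initDual O h1 hw)
  rwa [e1] at this

/-- The coordinate with the number in variable `17` of the vector of weights. -/
def evalCoord : Cmd :=
  .seq (.store 9 (.var 17) (.const 0))
    (.forLt 6 1 (.store 9 (.var 17) (.add (.read 9 (.var 17))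
      (.read 0 (.add (.read 3 (.var 17)) (.add (.read 2 (.read 6 (.var 6))) (.var 6)))))))

/-- Write the vector of the weights of the current matching into the array `9`. -/
def evaluate : Cmd :=
  .forLt 17 0 evalCoord

theorem exec_evalCoord {s : Store} {l : ℤ} (h17 : s.var 17 = l) :
    (evalCoord.exec O s).arr 9 = Function.update (s.arr 9) l
      (∑ j ∈ Finset.range (s.var 1).toNat, s.arr 0 (s.arr 3 l + (s.arr 2 (s.arr 6 j) + j))) := by
  rw [evalCoord, exec_seq, exec_store]
  simp only [Expr.eval, h17]
  refine exec_forLt O (x := 6) (b := 1) (s := s.setArr 9 l 0) (fun m s' => s'.arr 9 =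
    Function.update (s.arr 9) l
      (∑ j ∈ Finset.range m, s.arr 0 (s.arr 3 l + (s.arr 2 (s.arr 6 j) + j)))) ?_ ?_
  · simp
  · intro m s' hm h6 hvar harr ih
    have e17 : s'.var 17 = l := (hvar 17 (by decide)).trans h17
    have e : ∀ a, a ≠ 9 → s'.arr a = s.arr a := fun a ha =>
      (harr a (by simpa [Cmd.warrs] using ha)).trans (Store.setArr_arr_of_ne ha _ _ _)
    rw [exec_store]
    simp only [Store.setVar_arr, Store.setArr_arr_self, Expr.eval, e17, e 0 (by decide),
      e 2 (by decide), e 3 (by decide), e 6 (by decide), h6, ih, Function.update_self,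
      Function.update_idem, Finset.sum_range_succ]

theorem exec_evaluate {s : Store} (h0 : 0 ≤ s.var 0) (l : ℤ) (hl0 : 0 ≤ l) (hl : l < s.var 0) :
    (evaluate.exec O s).arr 9 l =
      ∑ j ∈ Finset.range (s.var 1).toNat, s.arr 0 (s.arr 3 l + (s.arr 2 (s.arr 6 j) + j)) := by
  refine exec_forLt O (x := 17) (b := 0) (s := s) (c := evalCoord) (fun m s' =>
    ∀ l : ℤ, 0 ≤ l → l < m → s'.arr 9 l =
      ∑ j ∈ Finset.range (s.var 1).toNat, s.arr 0 (s.arr 3 l + (s.arr 2 (s.arr 6 j) + j)))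
    ?_ ?_ l hl0 (by omega)
  · intro i h0 hi
    push_cast at hi
    omega
  · intro m s' hm h17 hvar harr ih i h0 hi
    have e1 : s'.var 1 = s.var 1 := hvar 1 (by decide)
    have e : ∀ a, a ≠ 9 → s'.arr a = s.arr a := fun a ha =>
      harr a (by simpa [Cmd.warrs, evalCoord] using ha)
    rw [Store.setVar_arr, exec_evalCoord O h17, e1, e 0 (by decide), e 2 (by decide),
      e 3 (by decide), e 6 (by decide)]
    by_cases him : i = m
    · subst him; simp
    · rw [Function.update_of_ne him]
      push_cast at hi
      exact ih i h0 (by omega)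

/-! ### Comparing the maximizers -/

/-- Enter the next multiple of `n`. -/
def rowTableStep : Cmd :=
  .seq (.store 2 (.var 6) (.var 14)) (.assign 14 (.add (.var 14) (.var 1)))

/-- Enter the next multiple of `n * n`. -/
def matrixTableStep : Cmd :=
  .seq (.store 3 (.var 3) (.var 14)) (.assign 14 (.add (.var 14) (.var 16)))

/-- Tabulate the multiples of `n` and of `n * n`, which serve to compute addresses without
multiplication, in the arrays `2` and `3`. -/
def tabulate : Cmd :=
  .seq (.assign 14 (.const 0)) (.seq (.forLt 6 1 rowTableStep)
    (.seq (.assign 16 (.var 14)) (.seq (.assign 14 (.const 0)) (.forLt 3 0 matrixTableStep))))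

theorem exec_tabulate {s : Store} {n : ℕ} (h0 : s.var 0 = d) (h1 : s.var 1 = n) :
    (∀ i : ℤ, 0 ≤ i → i < n → (tabulate.exec O s).arr 2 i = i * n) ∧
    (∀ k : ℤ, 0 ≤ k → k < d → (tabulate.exec O s).arr 3 k = k * (n * n)) := by
  rw [tabulate, exec_seq, exec_seq, exec_seq, exec_seq]
  set s₁ := exec O (.assign 14 (.const 0)) s with hs₁
  have e₁ : s₁.var 1 = n := h1
  have key := exec_forLt O (x := 6) (b := 1) (s := s₁) (c := rowTableStep) (fun m s' =>
    s'.var 14 = m * n ∧ ∀ i : ℤ, 0 ≤ i → i < m → s'.arr 2 i = i * n) ?_ ?_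
  · set s₂ := exec O (.forLt 6 1 rowTableStep) s₁ with hs₂
    rw [e₁, Int.toNat_natCast] at key
    have e₂ : s₂.var 0 = d := (Cmd.exec_var_of_notMem O (by decide) _).trans h0
    set s₃ := exec O (.assign 14 (.const 0)) (exec O (.assign 16 (.var 14)) s₂) with hs₃
    have e₃ : s₃.var 0 = d := e₂
    have e16 : s₃.var 16 = n * n := by
      simp [hs₃, exec_assign, Store.var_setVar, Expr.eval, key.1]
    have a2 : s₃.arr 2 = s₂.arr 2 := rfl
    refine ⟨fun i hi0 hi => ?_, ?_⟩
    · rw [Cmd.exec_arr_of_notMem O (by decide), a2]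
      exact key.2 i hi0 hi
    · have key' := exec_forLt O (x := 3) (b := 0) (s := s₃) (c := matrixTableStep) (fun m s' =>
        s'.var 14 = m * (n * n) ∧ ∀ k : ℤ, 0 ≤ k → k < m → s'.arr 3 k = k * (n * n)) ?_ ?_
      · rw [e₃, Int.toNat_natCast] at key'
        exact key'.2
      · refine ⟨by simp [hs₃, exec_assign, Store.var_setVar, Expr.eval], fun i hi0 hi => ?_⟩
        push_cast at hi
        omega
      · rintro m s' hm h3 hvar harr ⟨ih1, ih2⟩
        have e : s'.var 16 = n * n := (hvar 16 (by decide)).trans e16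
        simp only [matrixTableStep, exec_seq, exec_store, exec_assign, Expr.eval, Store.setVar_arr,
          Store.arr_setArr, Store.setArr_var, Store.var_setVar, Nat.reduceEqDiff, if_false,
          if_true, h3, ih1, e]
        refine ⟨by push_cast; ring, fun i hi0 hi => ?_⟩
        by_cases him : i = m
        · rw [him, Function.update_self]
        · rw [Function.update_of_ne him]
          push_cast at hi
          exact ih2 i hi0 (by omega)
  · refine ⟨by simp [hs₁, exec_assign, Store.var_setVar, Expr.eval], fun i hi0 hi => ?_⟩
    push_cast at hi
    omega
  · rintro m s' hm h6 hvar harr ⟨ih1, ih2⟩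
    have e : s'.var 1 = n := (hvar 1 (by decide)).trans e₁
    simp only [rowTableStep, exec_seq, exec_store, exec_assign, Expr.eval, Store.setVar_arr,
      Store.arr_setArr, Store.setArr_var, Store.var_setVar, Nat.reduceEqDiff, if_false,
      if_true, h6, ih1, e]
    refine ⟨by push_cast; ring, fun i hi0 hi => ?_⟩
    by_cases him : i = m
    · rw [him, Function.update_self]
    · rw [Function.update_of_ne him]
      push_cast at hi
      exact ih2 i hi0 (by omega)

/-- Copy the current matching and its vector of weights to the arrays `11` and `10`. -/
def copy : Cmd :=
  .seq (.forLt 6 0 (.store 10 (.var 6) (.read 9 (.var 6))))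
    (.forLt 6 1 (.store 11 (.var 6) (.read 6 (.var 6))))

theorem exec_copyArray {a b x : ℕ} (hab : b ≠ a) (s : Store) (j : ℤ) (hj0 : 0 ≤ j)
    (hj : j < s.var x) :
    ((Cmd.forLt 6 x (.store a (.var 6) (.read b (.var 6)))).exec O s).arr a j = s.arr b j := by
  refine exec_forLt O (x := 6) (b := x) (s := s) (c := .store a (.var 6) (.read b (.var 6)))
    (fun m s' => ∀ j : ℤ, 0 ≤ j → j < m → s'.arr a j = s.arr b j) ?_ ?_ j hj0 (by omega)
  · intro i h0 hi
    push_cast at hi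
    omega
  · intro m s' hm h6 hvar harr ih i h0 hi
    have e : s'.arr b = s.arr b := harr b (by simpa [Cmd.warrs] using hab)
    rw [exec_store]
    simp only [Store.setVar_arr, Store.setArr_arr_self, Expr.eval, h6, e]
    by_cases him : i = m
    · rw [him, Function.update_self]
    · rw [Function.update_of_ne him]
      push_cast at hi
      exact ih i h0 (by omega)

theorem exec_copy (s : Store) :
    (∀ l, 0 ≤ l → l < s.var 0 → (copy.exec O s).arr 10 l = s.arr 9 l) ∧
    (∀ j, 0 ≤ j → j < s.var 1 → (copy.exec O s).arr 11 j = s.arr 6 j) := by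
  rw [copy, exec_seq]
  set s₁ := exec O (.forLt 6 0 (.store 10 (.var 6) (.read 9 (.var 6)))) s with hs₁
  have e1 : s₁.var 1 = s.var 1 := Cmd.exec_var_of_notMem O (by decide) _
  have a6 : s₁.arr 6 = s.arr 6 := Cmd.exec_arr_of_notMem O (by decide) _
  refine ⟨fun l hl0 hl => ?_, fun j hj0 hj => ?_⟩
  · rw [Cmd.exec_arr_of_notMem O (by decide)]
    exact exec_copyArray O (by decide) s l hl0 hl
  · rw [exec_copyArray O (by decide) s₁ j hj0 (by rw [e1]; exact hj), a6]

/-- Solve the assignment problem for the matrix with index in variable `3`, and leave a matching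
and its vector of weights in the arrays `6` and `9`. -/
def maximize : Cmd :=
  .seq (.assign 8 (.read 3 (.var 3))) (.seq solve evaluate)

/-- Keep the better one of the best matching so far and the new one. -/
def improve : Cmd :=
  .seq maximize (.seq (.query 15 10 9) (.cond (.var 15) copy .skip))

/-- Write the permutation matrix of the best matching. -/
def output : Cmd :=
  .forLt 6 1 (.store 1 (.add (.read 2 (.read 11 (.var 6))) (.var 6)) (.const 1))

/-- The algorithm as a bounded program, which expects `n + 1` in variable `2`. -/
def program : Cmd :=
  .seq tabulate (.seq (.forLt 3 0 improve) output)

/-- The input and the address tables are in memory. -/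
structure Ready {n : ℕ} (w : Fin d → Matrix (Fin n) (Fin n) ℕ) (s : Store) : Prop where
  var_zero : s.var 0 = d
  var_one : s.var 1 = n
  var_two : s.var 2 = n + 1
  weights : ∀ (k : Fin d) (i j : Fin n),
    s.arr 0 (s.arr 3 (k : ℕ) + (s.arr 2 (i : ℕ) + (j : ℕ))) = w k i j
  bases : ∀ k : Fin d, s.arr 3 (k : ℕ) = (k : ℕ) * (n * n)
  rows : ∀ i : Fin n, s.arr 2 (i : ℕ) = (i : ℕ) * n

theorem Ready.exec {n : ℕ} {w : Fin d → Matrix (Fin n) (Fin n) ℕ} {s s' : Store}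
    (h : Ready w s) (hv : ∀ x ≤ 2, s'.var x = s.var x)
    (ha : s'.arr 0 = s.arr 0 ∧ s'.arr 2 = s.arr 2 ∧ s'.arr 3 = s.arr 3) : Ready w s' := by
  obtain ⟨h0, h2, h3⟩ := ha
  obtain ⟨r1, r2, r3, r4, r5, r6⟩ := h
  constructor <;> simpa only [h0, h2, h3, hv 0 (by norm_num), hv 1 (by norm_num), hv 2 le_rfl]

theorem Matching.exists_perm {n : ℕ} {p : ℤ → ℤ} (h : Matching n n n p) :
    ∃ σ : Equiv.Perm (Fin n), ∀ i, p ((σ i : Fin n) : ℕ) = (i : ℕ) := by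
  have h1 : ∀ i : Fin n, ∃ j : Fin n, p (j : ℕ) = (i : ℕ) := by
    intro i
    obtain ⟨j, h0, hn, hj, hp⟩ := h.surj (i : ℕ) (by omega) (by omega)
    refine ⟨⟨j.toNat, by omega⟩, ?_⟩
    simpa only [Int.toNat_of_nonneg h0] using hp
  choose f hf using h1
  have hinj : Function.Injective f := by
    intro i i' hii
    have := hf i
    rw [hii, hf i'] at this
    ext
    omega
  exact ⟨Equiv.ofBijective f (Finite.injective_iff_bijective.1 hinj), hf⟩

/-- The matching `σ` maximizes the `k`-th linear objective over the Birkhoff polytope. -/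
def IsLinearMaximizer {n : ℕ} (w : Fin d → Matrix (Fin n) (Fin n) ℕ) (k : Fin d)
    (σ : Equiv.Perm (Fin n)) : Prop :=
  ∀ x ∈ doublyStochastic ℝ (Fin n), proj w x k ≤ proj w (σ.permMatrix ℝ) k

theorem exec_maximize {n : ℕ} {w : Fin d → Matrix (Fin n) (Fin n) ℕ} {s : Store}
    (hs : Ready w s) (k : Fin d) (h3 : s.var 3 = (k : ℕ)) :
    ∃ σ : Equiv.Perm (Fin n), IsLinearMaximizer w k σ ∧
      (∀ l : Fin d, ((maximize.exec O s).arr 9 (l : ℕ) : ℝ) = proj w (σ.permMatrix ℝ) l) ∧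
      ∀ i, (maximize.exec O s).arr 6 ((σ i : Fin n) : ℕ) = (i : ℕ) := by
  rw [maximize, exec_seq, exec_seq]
  set s₁ := exec O (.assign 8 (.read 3 (.var 3))) s with hs₁
  have r₁ : Ready w s₁ := hs.exec
    (fun x hx => by rw [hs₁, exec_assign, Store.setVar_var_of_ne (by omega)]) ⟨rfl, rfl, rfl⟩
  have e8 : s₁.var 8 = s.arr 3 (k : ℕ) := by simp [hs₁, exec_assign, Expr.eval, h3]
  have hw : ∀ i j : Fin n, weight s₁ (i : ℕ) (j : ℕ) = w k i j := by
    intro i j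
    rw [weight, e8]
    exact hs.weights k i j
  have hsol := exec_solve O (s := s₁) (by rw [r₁.var_one]; positivity)
    (by rw [r₁.var_one, r₁.var_two]) (by
      rw [r₁.var_one]
      intro i j hi hin hj hjn
      have := hw ⟨i.toNat, by omega⟩ ⟨j.toNat, by omega⟩
      simp only [Int.toNat_of_nonneg hi, Int.toNat_of_nonneg hj] at this
      rw [this]
      positivity)
  set s₂ := solve.exec O s₁ with hs₂
  have v₂ : ∀ x, x ∉ solve.wvars → s₂.var x = s₁.var x := fun x hx =>
    Cmd.exec_var_of_notMem O hx _
  have a₂ : ∀ a, a ∉ solve.warrs → s₂.arr a = s₁.arr a := fun x hx =>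
    Cmd.exec_arr_of_notMem O hx _
  have r₂ : Ready w s₂ := r₁.exec
    (fun x hx => v₂ x (Cmd.tame_notMem_wvars (by decide) hx))
    ⟨a₂ 0 (by decide), a₂ 2 (by decide), a₂ 3 (by decide)⟩
  have ew : weight s₂ = weight s₁ := weight_congr (a₂ 0 (by decide)) (a₂ 2 (by decide))
    (v₂ 8 (by decide))
  obtain ⟨hm, hf, ht⟩ := hsol
  rw [r₁.var_one, r₂.var_one] at hm
  rw [r₂.var_one, ew] at hf ht
  obtain ⟨σ, hσ⟩ := hm.exists_perm
  refine ⟨σ, ?_, fun l => ?_, fun i => ?_⟩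
  · intro x hx
    refine proj_le_of_dual (u := fun i => s₂.arr 4 (i : ℕ)) (v := fun j => s₂.arr 5 (j : ℕ))
      (fun i j => ?_) (fun i => ?_) hx
    · rw [← hw]
      exact hf _ _ (by omega) (by omega) (by omega) (by omega)
    · rw [← hw]
      have := ht ((σ i : Fin n) : ℕ) (by omega) (by omega) (by omega) (by rw [hσ]; omega)
      rwa [hσ] at this
  · rw [exec_evaluate O (by rw [r₂.var_zero]; positivity) _ (by positivity)
      (by rw [r₂.var_zero]; exact_mod_cast l.2), r₂.var_one, Int.toNat_natCast,
      Finset.sum_range, ← Equiv.sum_comp σ, proj_permMatrix]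
    push_cast
    refine Finset.sum_congr rfl fun i _ => ?_
    rw [hσ, r₂.weights]
    norm_cast
  · rw [Cmd.exec_arr_of_notMem O (by decide)]
    exact hσ i

/-- The invariant of the main loop: the arrays `10` and `11` hold the best one of maximizers of
the first `m` linear objectives. -/
def Best {n : ℕ} (p : ℝ≥0∞) (w : Fin d → Matrix (Fin n) (Fin n) ℕ) (m : ℕ) (s : Store) : Prop :=
  (∀ k : Fin d, (k : ℕ) < m → ∃ τ, IsLinearMaximizer w k τ ∧
    objective p w τ ≤ lpNorm p fun l : Fin d => (s.vec d 10 l : ℝ)) ∧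
  (m = 0 ∧ s.vec d 10 = 0 ∨ ∃ (r : Fin d) (σ : Equiv.Perm (Fin n)), IsLinearMaximizer w r σ ∧
    (∀ l, (s.vec d 10 l : ℝ) = proj w (σ.permMatrix ℝ) l) ∧
    ∀ i, s.arr 11 ((σ i : Fin n) : ℕ) = (i : ℕ))

theorem exec_query {d : ℕ} (O : (Fin d → ℤ) → (Fin d → ℤ) → Prop) (x a b : ℕ) (s : Store) :
    O (s.vec d a) (s.vec d b) ∧ exec O (.query x a b) s = s.setVar x 1 ∨
    ¬ O (s.vec d a) (s.vec d b) ∧ exec O (.query x a b) s = s.setVar x 0 := by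
  by_cases h : O (s.vec d a) (s.vec d b)
  · exact Or.inl ⟨h, by simp [exec, h]⟩
  · exact Or.inr ⟨h, by simp [exec, h]⟩

theorem exec_improve {n : ℕ} {p : ℝ≥0∞} (hp : 1 ≤ p) {w : Fin d → Matrix (Fin n) (Fin n) ℕ}
    {s : Store} (hs : Ready w s) (k : Fin d) (h3 : s.var 3 = (k : ℕ)) (hb : Best p w k s) :
    Best p w (k + 1) (improve.exec (comparisonOracle p d) s) := by
  obtain ⟨σ, hσ, h9, h6⟩ := exec_maximize (comparisonOracle p d) hs k h3
  rw [improve, exec_seq, exec_seq]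
  set s₁ := maximize.exec (comparisonOracle p d) s with hs₁
  have v₁ : ∀ x ≤ 2, s₁.var x = s.var x := fun x hx =>
    Cmd.exec_var_of_notMem _ (Cmd.tame_notMem_wvars (by decide) hx) _
  have a10 : s₁.arr 10 = s.arr 10 := Cmd.exec_arr_of_notMem _ (by decide) _
  have a11 : s₁.arr 11 = s.arr 11 := Cmd.exec_arr_of_notMem _ (by decide) _
  have hvec : s₁.vec d 10 = s.vec d 10 := by funext l; simp [Store.vec, a10]
  have hnew : lpNorm p (fun l : Fin d => (s₁.vec d 9 l : ℝ)) = objective p w σ := by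
    rw [objective]; congr 1; funext l; exact h9 l
  have hlt : ∀ {k' : Fin d}, (k' : ℕ) < k + 1 → (k' : ℕ) < k ∨ k' = k := fun {k'} h => by
    rcases Nat.lt_succ_iff_lt_or_eq.1 h with h | h
    · exact Or.inl h
    · exact Or.inr (Fin.ext h)
  rcases exec_query (comparisonOracle p d) 15 10 9 s₁ with ⟨hq, hx⟩ | ⟨hq, hx⟩
  · rw [hx, exec_cond_of_ne _ (by simp [Expr.eval])]
    obtain ⟨c1, c2⟩ := exec_copy (comparisonOracle p d) (s₁.setVar 15 1)
    rw [Store.setVar_var_of_ne (by decide), v₁ 0 (by norm_num), hs.var_zero] at c1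
    rw [Store.setVar_var_of_ne (by decide), v₁ 1 (by norm_num), hs.var_one] at c2
    set s₂ := copy.exec (comparisonOracle p d) (s₁.setVar 15 1) with hs₂
    have hvec₂ : s₂.vec d 10 = s₁.vec d 9 := by
      funext l
      exact c1 _ (by positivity) (by exact_mod_cast l.2)
    rw [comparisonOracle, hvec] at hq
    refine ⟨fun k' hk' => ?_, Or.inr ⟨k, σ, hσ, fun l => ?_, fun i => ?_⟩⟩
    · rw [hvec₂]
      rcases hlt hk' with hk' | rfl
      · obtain ⟨τ, hτ, hle⟩ := hb.1 k' hk'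
        exact ⟨τ, hτ, hle.trans hq⟩
      · exact ⟨σ, hσ, hnew.ge⟩
    · rw [hvec₂]; exact h9 l
    · rw [c2 _ (by positivity) (by exact_mod_cast (σ i).2)]
      exact h6 i
  · rw [hx, exec_cond_of_eq _ (by simp [Expr.eval]), exec_skip]
    have hvec₂ : (s₁.setVar 15 0).vec d 10 = s.vec d 10 := hvec
    rw [comparisonOracle, hvec, hnew, not_le] at hq
    refine ⟨fun k' hk' => ?_, Or.inr ?_⟩
    · rw [hvec₂]
      rcases hlt hk' with hk' | rfl
      · exact hb.1 k' hk'
      · exact ⟨σ, hσ, hq.le⟩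
    · rw [hvec₂, Store.setVar_arr, a11]
      refine hb.2.resolve_left ?_
      rintro ⟨-, hz⟩
      -- The first comparison is with the zero vector, so the oracle cannot have denied it.
      rw [hz] at hq
      simp only [Pi.zero_apply, Int.cast_zero, lpNorm_zero hp] at hq
      exact absurd (lpNorm_nonneg hp _) (not_le.2 hq)

theorem Best.isBestOfLinearMaximizers {n : ℕ} {p : ℝ≥0∞} (hd : 0 < d)
    {w : Fin d → Matrix (Fin n) (Fin n) ℕ} {s : Store} (hb : Best p w d s) :
    ∃ σ, IsBestOfLinearMaximizers p w σ ∧ ∀ i, s.arr 11 ((σ i : Fin n) : ℕ) = (i : ℕ) := by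
  obtain ⟨h1, h2⟩ := hb
  obtain ⟨r, σ, hσ, hv, h11⟩ := h2.resolve_left (by omega)
  have hobj : (lpNorm p fun l : Fin d => (s.vec d 10 l : ℝ)) = objective p w σ := by
    rw [objective]; congr 1; funext l; exact hv l
  rw [hobj] at h1
  choose τ hτ hle using fun k : Fin d => h1 k k.2
  refine ⟨σ, ⟨Function.update τ r σ, fun k => ?_, r, fun k => ?_, by simp⟩, h11⟩
  · by_cases hk : k = r
    · subst hk; rw [Function.update_self]; exact hσ
    · rw [Function.update_of_ne hk]; exact hτ k
  · rw [Function.update_self]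
    by_cases hk : k = r
    · subst hk; rw [Function.update_self]
    · rw [Function.update_of_ne hk]; exact hle k

theorem exec_output {n : ℕ} {w : Fin d → Matrix (Fin n) (Fin n) ℕ} {s : Store}
    (hs : Ready w s) (h1 : ∀ m, s.arr 1 m = 0) {σ : Equiv.Perm (Fin n)}
    (hσ : ∀ i, s.arr 11 ((σ i : Fin n) : ℕ) = (i : ℕ)) : IsOutput (output.exec O s) σ := by
  have key := exec_forLt O (x := 6) (b := 1) (s := s)
    (c := .store 1 (.add (.read 2 (.read 11 (.var 6))) (.var 6)) (.const 1)) (fun m s' =>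
      ∀ i j : Fin n, s'.arr 1 (((i : ℕ) * n + j : ℕ) : ℤ) =
        if σ i = j ∧ (j : ℕ) < m then 1 else 0) ?_ ?_
  · rw [hs.var_one, Int.toNat_natCast] at key
    intro i j
    refine (key i j).trans ?_
    simp [Equiv.Perm.permMatrix, PEquiv.toMatrix_apply, eq_comm]
  · intro i j
    simp [h1]
  · intro m s' hm h6 hvar harr ih i j
    rw [hs.var_one] at hm
    have hmn : m < n := by exact_mod_cast hm
    obtain ⟨i₀, hi₀⟩ := σ.surjective ⟨m, hmn⟩
    have e11 : s'.arr 11 m = (i₀ : ℕ) := by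
      rw [harr 11 (by decide), ← hσ i₀, hi₀]
    have e2 : s'.arr 2 (i₀ : ℕ) = (i₀ : ℕ) * n := by
      rw [harr 2 (by decide), hs.rows]
    rw [exec_store]
    simp only [Store.setVar_arr, Store.setArr_arr_self, Expr.eval, h6, e11, e2]
    by_cases hjm : i = i₀ ∧ (j : ℕ) = m
    · obtain ⟨rfl, hj⟩ := hjm
      have hij : σ i = j := by rw [hi₀]; exact Fin.ext hj.symm
      rw [if_pos ⟨hij, by omega⟩, hj]
      push_cast
      rw [Function.update_self]
    · rw [Function.update_of_ne]
      · rw [ih]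
        refine if_congr (and_congr_right fun hij => ?_) rfl rfl
        have : (j : ℕ) ≠ m := by
          rintro hj
          refine hjm ⟨σ.injective ?_, hj⟩
          rw [hij, hi₀]
          exact Fin.ext hj
        omega
      · intro heq
        have heq' : (i : ℕ) * n + j = (i₀ : ℕ) * n + m := by exact_mod_cast heq
        have hmod := congrArg (· % n) heq'
        simp only [Nat.mul_add_mod_self_right, Nat.mod_eq_of_lt j.2, Nat.mod_eq_of_lt hmn] at hmod
        refine hjm ⟨Fin.ext ?_, hmod⟩
        rw [hmod] at heq'
        exact Nat.eq_of_mul_eq_mul_right (by omega) (Nat.add_right_cancel heq')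

theorem exec_program {n : ℕ} (hd : 0 < d) {p : ℝ≥0∞} (hp : 1 ≤ p)
    {w : Fin d → Matrix (Fin n) (Fin n) ℕ} {s : Store} (hs : IsInput w s) :
    ∃ σ, IsBestOfLinearMaximizers p w σ ∧
      IsOutput (program.exec (comparisonOracle p d) (s.setVar 2 (n + 1))) σ := by
  obtain ⟨i0, i1, -, i3, -, i5⟩ := hs
  rw [program, exec_seq, exec_seq]
  set s₀ := s.setVar 2 ((n : ℤ) + 1) with hs₀
  have e0 : s₀.var 0 = d := by rw [hs₀, Store.setVar_var_of_ne (by decide), i0]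
  have e1 : s₀.var 1 = n := by rw [hs₀, Store.setVar_var_of_ne (by decide), i1]
  obtain ⟨t2, t3⟩ := exec_tabulate (comparisonOracle p d) e0 e1
  set s₁ := tabulate.exec (comparisonOracle p d) s₀ with hs₁
  have v₁ : ∀ x ≤ 2, s₁.var x = s₀.var x := fun x hx =>
    Cmd.exec_var_of_notMem _ (Cmd.tame_notMem_wvars (by decide) hx) _
  have a₁ : ∀ a, a ∉ tabulate.warrs → s₁.arr a = s.arr a := fun a ha =>
    Cmd.exec_arr_of_notMem _ ha _
  have hk : ∀ k : Fin d, s₁.arr 3 (k : ℕ) = (k : ℕ) * (n * n) := fun k =>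
    t3 _ (by positivity) (by exact_mod_cast k.2)
  have hi : ∀ i : Fin n, s₁.arr 2 (i : ℕ) = (i : ℕ) * n := fun i =>
    t2 _ (by positivity) (by exact_mod_cast i.2)
  have r₁ : Ready w s₁ := by
    refine ⟨?_, ?_, ?_, fun k i j => ?_, hk, hi⟩
    · rw [v₁ 0 (by norm_num), e0]
    · rw [v₁ 1 (by norm_num), e1]
    · rw [v₁ 2 (by norm_num), hs₀, Store.setVar_var_self]
    · rw [hk, hi, a₁ 0 (by decide), ← i3 k i j]
      congr 1
      push_cast
      ring
  have hready : ∀ s', (∀ x ≤ 2, s'.var x = s₁.var x) → (∀ a ≤ 3, a ≠ 1 → s'.arr a = s₁.arr a) →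
      Ready w s' := fun s' hv ha => r₁.exec hv
    ⟨ha 0 (by norm_num) (by decide), ha 2 (by norm_num) (by decide), ha 3 le_rfl (by decide)⟩
  have htame : ∀ x ≤ 2, x ∉ (Cmd.forLt 3 0 improve).wvars := fun x hx =>
    Cmd.tame_notMem_wvars (by decide) hx
  have harrs : ∀ a ≤ 3, a ∉ (Cmd.forLt 3 0 improve).warrs := by decide
  have key := exec_forLt (comparisonOracle p d) (x := 3) (b := 0) (s := s₁) (c := improve)
    (fun m s' => Best p w m s') ?_ ?_
  · set s₂ := exec (comparisonOracle p d) (.forLt 3 0 improve) s₁ with hs₂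
    have r₂ : Ready w s₂ := hready _ (fun x hx => Cmd.exec_var_of_notMem _ (htame x hx) _)
      fun a ha _ => Cmd.exec_arr_of_notMem _ (harrs a ha) _
    rw [r₁.var_zero, Int.toNat_natCast] at key
    obtain ⟨σ, hσ, h11⟩ := key.isBestOfLinearMaximizers hd
    refine ⟨σ, hσ, exec_output _ r₂ (fun m => ?_) h11⟩
    rw [hs₂, Cmd.exec_arr_of_notMem _ (harrs 1 (by norm_num)), a₁ 1 (by decide)]
    exact i5 1 le_rfl m
  · refine ⟨fun k hk => absurd hk (by omega), Or.inl ⟨rfl, ?_⟩⟩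
    funext l
    change s₁.arr 10 _ = 0
    rw [a₁ 10 (by decide)]
    exact i5 10 (by norm_num) _
  · intro m s' hm h3 hvar harr ih
    rw [r₁.var_zero] at hm
    have r' : Ready w s' := hready _ (fun x hx => hvar x (htame x hx))
      fun a ha _ => harr a (harrs a ha)
    exact exec_improve hp r' ⟨m, by exact_mod_cast hm⟩ h3 ih

/-! ### Polynomial oracle-time -/

/-- The dimensions `d` and `n` are bounded by their values, as the running time may depend on these
polynomially. -/
theorem bounded_of_isInput {n : ℕ} {w : Fin d → Matrix (Fin n) (Fin n) ℕ} {s : Store}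
    (hs : IsInput w s) : s.Bounded (d + n + maxBitSize w) := by
  obtain ⟨i0, i1, i2, i3, i4, i5⟩ := hs
  have hsize : ∀ m : ℕ, m.size ≤ m := fun m => Nat.size_le.2 Nat.lt_two_pow_self
  refine ⟨fun x => ?_, fun a m => ?_⟩
  · rcases Nat.lt_or_ge x 2 with hx | hx
    · interval_cases x
      · rw [i0, Int.natAbs_natCast]; have := hsize d; omega
      · rw [i1, Int.natAbs_natCast]; have := hsize n; omega
    · rw [i2 x hx]; simp
  · rcases Nat.eq_zero_or_pos a with rfl | ha
    · by_cases hm : m < 0 ∨ ((d * n * n : ℕ) : ℤ) ≤ m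
      · rw [i4 m hm]; simp
      · push Not at hm
        obtain ⟨M, rfl⟩ := Int.eq_ofNat_of_zero_le hm.1
        have hM : M < d * n * n := by exact_mod_cast hm.2
        have hn : 0 < n := Nat.pos_of_ne_zero (by rintro rfl; simp at hM)
        have hq : M / n < d * n := Nat.div_lt_of_lt_mul (by rwa [mul_comm])
        have hk : M / n / n < d := Nat.div_lt_of_lt_mul (by rwa [mul_comm])
        have := i3 ⟨M / n / n, hk⟩ ⟨M / n % n, Nat.mod_lt _ hn⟩ ⟨M % n, Nat.mod_lt _ hn⟩
        simp only [Nat.div_add_mod'] at this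
        rw [this, Int.natAbs_natCast]
        have hle := Finset.le_sup (f := fun t : Fin d × Fin n × Fin n => (w t.1 t.2.1 t.2.2).size)
          (Finset.mem_univ
            (⟨M / n / n, hk⟩, ⟨M / n % n, Nat.mod_lt _ hn⟩, ⟨M % n, Nat.mod_lt _ hn⟩))
        exact hle.trans (Nat.le_add_left _ _)
    · rw [i5 a ha]; simp

/-- The program, preceded by an assignment of `n + 1` to the variable `2`, which bounds the loops
over all columns including the artificial one. -/
def algorithm : Prog :=
  .seq (.assign 2 (.add (.var 1) (.const 1))) program.compile

theorem exists_run_algorithm : ∃ P : MvPolynomial (Fin 3) ℕ,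
    ∀ (d n : ℕ) (O : (Fin d → ℤ) → (Fin d → ℤ) → Prop)
      (w : Fin d → Matrix (Fin n) (Fin n) ℕ) (s : Store), IsInput w s →
      ∃ t ≤ MvPolynomial.eval ![d, n, maxBitSize w] P,
        Run O algorithm s
          (program.exec O (s.setVar 2 (n + 1))) t := by
  obtain ⟨_, P, hP⟩ := Cmd.exists_run program (by decide)
  refine ⟨Polynomial.aeval (2 * .X 0 + 2 * .X 1 + .X 2 + 2 : MvPolynomial (Fin 3) ℕ) P
    + (2 * .X 1 + 10), fun d n O w s hs => ?_⟩
  have hB := bounded_of_isInput hs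
  obtain ⟨i0, i1, -, -, -, -⟩ := hs
  have hsize : ∀ m : ℕ, m.size ≤ m := fun m => Nat.size_le.2 Nat.lt_two_pow_self
  have hcast : ((n : ℤ) + 1) = ((n + 1 : ℕ) : ℤ) := by push_cast; rfl
  obtain ⟨-, t, ht, hr⟩ := hP d O (s.setVar 2 ((n : ℤ) + 1)) (d + n + 1)
    (d + n + maxBitSize w + 1) (by omega) (by
      intro x hx
      interval_cases x
      · rw [Store.setVar_var_of_ne (by decide), i0]; push_cast; omega
      · rw [Store.setVar_var_of_ne (by decide), i1]; push_cast; omega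
      · rw [Store.setVar_var_self]; push_cast; omega)
    ((hB.mono (Nat.le_succ _)).setVar 2 (by
      rw [hcast, Int.natAbs_natCast]; have := hsize (n + 1); omega))
  have he : (Expr.add (.var 1) (.const 1)).eval s = n + 1 := by simp [Expr.eval, i1]
  have hc : (Expr.add (.var 1) (.const 1)).cost s ≤ 2 * n + 8 := by
    simp only [Expr.cost, Expr.eval, i1, bitCost]
    rw [hcast, Int.natAbs_natCast, Int.natAbs_natCast]
    have := hsize (n + 1)
    have := hsize n
    simp
    omega
  have ha := Run.assign (O := O) 2 (.add (.var 1) (.const 1)) s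
  rw [he] at ha
  refine ⟨_, ?_, Run.seq ha hr⟩
  have heval : MvPolynomial.eval ![d, n, maxBitSize w]
      (Polynomial.aeval (2 * .X 0 + 2 * .X 1 + .X 2 + 2 : MvPolynomial (Fin 3) ℕ) P)
      = P.eval (2 * d + 2 * n + maxBitSize w + 2) := by
    rw [Polynomial.aeval_def, Polynomial.hom_eval₂, Polynomial.eval, Subsingleton.elim
      ((MvPolynomial.eval ![d, n, maxBitSize w]).comp (algebraMap ℕ (MvPolynomial (Fin 3) ℕ)))
      (RingHom.id ℕ)]
    simp
  have hX : d + n + 1 + (d + n + maxBitSize w + 1) = 2 * d + 2 * n + maxBitSize w + 2 := by ring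
  rw [hX] at ht
  rw [map_add, heval]
  simp only [map_add, map_mul, MvPolynomial.eval_X, map_ofNat]
  simp
  omega

end Hungarian

open NonlinearMatching OracleRAM in
theorem theorem4p2 :
    (∀ (d n : ℕ), 0 < d → 0 < n → ∀ p : ℝ≥0∞, 1 ≤ p →
      ∀ (w : Fin d → Matrix (Fin n) (Fin n) ℕ) (σ : Equiv.Perm (Fin n)),
        IsBestOfLinearMaximizers p w σ →
          IsApproximative (objective p w) ((d : ℝ) ^ (1 / p).toReal) σ ∧
          (p = ∞ → IsOptimal (objective p w) σ)) ∧
    (∃ (A : Prog) (P : MvPolynomial (Fin 3) ℕ),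
      ∀ (d n : ℕ), 0 < d → 0 < n → ∀ p : ℝ≥0∞, 1 ≤ p →
        ∀ (w : Fin d → Matrix (Fin n) (Fin n) ℕ) (s : Store), IsInput w s →
          ∃ (s' : Store) (t : ℕ) (σ : Equiv.Perm (Fin n)),
            Run (comparisonOracle p d) A s s' t ∧
            t ≤ MvPolynomial.eval ![d, n, maxBitSize w] P ∧
            IsOutput s' σ ∧
            IsBestOfLinearMaximizers p w σ ∧
            IsApproximative (objective p w) ((d : ℝ) ^ (1 / p).toReal) σ ∧
            (p = ∞ → IsOptimal (objective p w) σ)) := by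
  refine ⟨fun d n hd _ p hp w σ h => h.isApproximative hd hp, ?_⟩
  obtain ⟨P, hP⟩ := Hungarian.exists_run_algorithm
  refine ⟨Hungarian.algorithm, P, fun d n hd _ p hp w s hs => ?_⟩
  obtain ⟨t, ht, hr⟩ := hP d n (comparisonOracle p d) w s hs
  obtain ⟨σ, hσ, hout⟩ := Hungarian.exec_program hd hp hs
  exact ⟨_, t, σ, hr, ht, hout, hσ, hσ.isApproximative hd hp⟩
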